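/- **Theorem 2 (Middle-range Lieb–Robinson bound).** *Lattice.* Let $\Lambda$ be a finite connected graph with shortest-path distance $d_{i,j}$. For nonempty $X,Y\subseteq\Lambda$ put $d_{X,Y}=\min_{i\in X,j\in Y}d_{i,j}$; put $\mathrm{diam}(X)=1+\max_{i,j\in X}d_{i,j}$ and $X[r]=\{j: d_{X,j}\le r\}$. For $\xi>0$ let $N_\xi(X)$ be the least cardinality of a set $Z\subseteq\Lambda$ with $X\subseteq Z[\xi]$. Let $D\ge1$ be an integer and $\gamma\ge1$. Assume that $\Lambda$ is $D$-dimensional with geometric parameter $\gamma$, i.e. 1. $|X|\le\gamma\,\mathrm{diam}(X)^D$ for all $X\subseteq\Lambda$; 2. $|\{i\}[r]|\le\gamma(2r)^D$ for all $i\in\Lambda$ and $r\ge1$; 3. $N_\xi(X)\le\max\bigl(1,\gamma(\mathrm{diam}(X)/\xi)^D\bigr)$ for all $X\subseteq\Lambda$ and $\xi>0$; 4. for every $\xi\ge1$ there is a set $\Lambda^{(\xi)}\subseteq\Lambda$ of least cardinality with $\Lambda^{(\xi)}[\xi]=\Lambda$ such that $\#\{j\in\Lambda^{(\xi)}: r\le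 d_{i,j}<r+\xi\}\le2\gamma D(2r/\xi)^{D-1}$ for all $i\in\Lambda$ and $r\ge\xi$. *Hamiltonian.* To every site a Hilbert space of finite dimension $\geq 1$ is assigned (arbitrary, possibly site dependent). Let $H=\sum_{Z\subseteq\Lambda}h_Z$, where $h_Z$ is Hermitian and acts on the sites of $Z$ (no restriction on $|Z|$), and assume, with $\alpha>2D+1$ and $g>0$, $$\sup_{i\in\Lambda}\ \sum_{Z\ni i,\ \mathrm{diam}(Z)\ge r}\|h_Z\|\le g\,r^{-\alpha+D}\qquad\text{for all } r\ge1 .$$ For $\ell>0$ let $H_{\le\ell}=\sum_{Z:\,\mathrm{diam}(Z)\le\ell}h_Z$, and write $O(A,t)=e^{iAt}Oe^{-iAt}$; $\|\cdot\|$ is the operator norm. *Claim.* There is a constant $v^\ast>0$ which depends only on $D,\alpha,\gamma,g$ (in particular not on $\Lambda$, the local dimensions, $H$ or $\ell$) such that for every $\ell>0$, all nonempty $X,Y\subseteq\Lambda$, all operators $O_X,O_Y$ supported on $X$ and $Y$, and all $t\in\mathbb R$, with $x=d_{X,Y}$, $$\|[O_X(H_{\le\ell},t),O_Y]\|\le\|O_X\|\,\|O_Y\|\,\min\Bigl(2,\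 \tilde{\mathcal C}_0\,|X|^2\,(1+x/\ell)^{D-1}e^{-2(x-v^\ast|t|)/\ell}\Bigr),$$ where $$\tilde{\mathcal C}_0=\tfrac43e^{10/3}\,15^D\,D!\,\gamma\,\zeta_2,\qquad \zeta_2=16e^3\gamma^2\,45^D .$$ -/

import Mathlib

open scoped Matrix.Norms.L2Operator Nat

noncomputable section

namespace LongRange

/-! ### Geometry of the lattice

A lattice is a finite connected simple graph with the shortest-path distance `G.dist`. -/

section Geometry

variable {V : Type*} [Fintype V] [DecidableEq V]

/-- `diam X = 1 + max_{i, j ∈ X} d(i, j)`. -/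
def diam (G : SimpleGraph V) (X : Finset V) : ℕ :=
  1 + X.sup fun i => X.sup fun j => G.dist i j

/-- The distance `d(X, Y) = min_{i ∈ X, j ∈ Y} d(i, j)` (only used for nonempty sets). -/
def setDist (G : SimpleGraph V) (X Y : Finset V) : ℕ :=
  sInf {n : ℕ | ∃ i ∈ X, ∃ j ∈ Y, G.dist i j = n}

open Classical in
/-- The extended set `X[r] = {j | d(X, j) ≤ r}`. -/
def extend (G : SimpleGraph V) (X : Finset V) (r : ℝ) : Finset V :=
  Finset.univ.filter fun j => ∃ i ∈ X, (G.dist i j : ℝ) ≤ r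

/-- The least cardinality of a set `Z` of vertices whose extension `Z[ξ]` contains `X`. -/
def coverNumber (G : SimpleGraph V) (X : Finset V) (ξ : ℝ) : ℕ :=
  sInf {n : ℕ | ∃ Z : Finset V, X ⊆ extend G Z ξ ∧ Z.card = n}

/-- `S` is a coarse-grained total set at scale `ξ`: a set of least cardinality
with `S[ξ] = Λ`. -/
def IsCoarseGraining (G : SimpleGraph V) (ξ : ℝ) (S : Finset V) : Prop :=
  extend G S ξ = Finset.univ ∧ S.card = coverNumber G Finset.univ ξ

open Classical in
/-- `G` is a `D`-dimensional lattice with geometric parameter `γ`. -/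
structure IsLattice (G : SimpleGraph V) (D : ℕ) (γ : ℝ) : Prop where
  connected : G.Connected
  card_le : ∀ X : Finset V, (X.card : ℝ) ≤ γ * (diam G X : ℝ) ^ D
  card_ball_le : ∀ (i : V) (r : ℝ), 1 ≤ r →
    ((extend G {i} r).card : ℝ) ≤ γ * (2 * r) ^ D
  coverNumber_le : ∀ (X : Finset V) (ξ : ℝ), 0 < ξ →
    (coverNumber G X ξ : ℝ) ≤ max 1 (γ * ((diam G X : ℝ) / ξ) ^ D)
  card_shell_le : ∀ ξ : ℝ, 1 ≤ ξ → ∃ S : Finset V, IsCoarseGraining G ξ S ∧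
    ∀ (i : V) (r : ℝ), ξ ≤ r →
      ((S.filter fun j => r ≤ (G.dist i j : ℝ) ∧ (G.dist i j : ℝ) < r + ξ).card : ℝ)
        ≤ 2 * γ * D * (2 * r / ξ) ^ (D - 1)

end Geometry

/-! ### Operators of the spin system

The spin at the site `i` has a Hilbert space of finite dimension `d i`.  Operators on the tensor
product are complex matrices indexed by the spin configurations, with the operator norm. -/

section Operators

variable {V : Type*} [Fintype V] [DecidableEq V]

/-- Operators on `⨂ i, ℂ ^ (d i)`. -/
abbrev Op (d : V → ℕ) : Type _ :=
  Matrix ((i : V) → Fin (d i)) ((i : V) → Fin (d i)) ℂ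

/-- `A` is supported on `X`, i.e. `A = B ⊗ 1` with `B` an operator on the spins in `X` and `1` the
identity on the other spins. -/
def SupportedOn {d : V → ℕ} (A : Op d) (X : Finset V) : Prop :=
  ∃ B : Matrix ((i : X) → Fin (d i)) ((i : X) → Fin (d i)) ℂ,
    ∀ s s' : (i : V) → Fin (d i),
      ((∀ i, i ∉ X → s i = s' i) → A s s' = B (fun i => s i) (fun i => s' i)) ∧
      ((∃ i, i ∉ X ∧ s i ≠ s' i) → A s s' = 0)

/-- The time evolution `O(A, t) = e^{iAt} O e^{-iAt}`. -/
def evolve {d : V → ℕ} (A O : Op d) (t : ℝ) : Op d :=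
  NormedSpace.exp ((Complex.I * (t : ℂ)) • A) * O *
    NormedSpace.exp (-((Complex.I * (t : ℂ)) • A))

/-- The Hamiltonian `H₀` satisfies the `𝒢(x, t, X)`-Lieb–Robinson bound, with the cut-off at the
trivial value `2`. -/
def LiebRobinsonBound (G : SimpleGraph V) {d : V → ℕ} (H₀ : Op d)
    (𝒢 : ℝ → ℝ → Finset V → ℝ) : Prop :=
  ∀ (X Y : Finset V), X.Nonempty → Y.Nonempty → ∀ (OX OY : Op d),
    SupportedOn OX X → SupportedOn OY Y → ∀ t : ℝ,
      ‖evolve H₀ OX t * OY - OY * evolve H₀ OX t‖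
        ≤ ‖OX‖ * ‖OY‖ * min 2 (𝒢 (setDist G X Y : ℝ) t X)

/-- A family of interaction terms: every `h Z` is Hermitian and acts on the sites in `Z`.
The Hamiltonian is `H = ∑ Z, h Z`; there is no restriction on the size of `Z`. -/
structure IsInteraction {d : V → ℕ} (h : Finset V → Op d) : Prop where
  isHermitian : ∀ Z, (h Z).IsHermitian
  supportedOn : ∀ Z, SupportedOn (h Z) Z

open Classical in
/-- Power-law decay:
`sup_i ∑_{Z ∋ i, diam Z ≥ r} ‖h Z‖ ≤ g r ^ (-α + D)` for all `r ≥ 1`. -/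
def PowerLawDecay (G : SimpleGraph V) {d : V → ℕ} (h : Finset V → Op d)
    (D : ℕ) (α g : ℝ) : Prop :=
  ∀ (i : V) (r : ℝ), 1 ≤ r →
    ∑ Z ∈ Finset.univ.filter (fun Z : Finset V => i ∈ Z ∧ r ≤ (diam G Z : ℝ)), ‖h Z‖
      ≤ g * r ^ (-α + (D : ℝ))

open Classical in
/-- The truncated Hamiltonian `H_{≤ ℓ} = ∑_{Z : diam Z ≤ ℓ} h Z`. -/
def truncated (G : SimpleGraph V) {d : V → ℕ} (h : Finset V → Op d) (ℓ : ℝ) : Op d :=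
  ∑ Z ∈ Finset.univ.filter (fun Z : Finset V => (diam G Z : ℝ) ≤ ℓ), h Z

end Operators

/-- `ζ₂ = 16 e³ γ² 45^D`. -/
def zeta2 (D : ℕ) (γ : ℝ) : ℝ :=
  16 * Real.exp 3 * γ ^ 2 * 45 ^ D

/-- `C̃₀ = (4/3) e^{10/3} 15^D D! γ ζ₂`. -/
def C0 (D : ℕ) (γ : ℝ) : ℝ :=
  4 / 3 * Real.exp (10 / 3) * 15 ^ D * (D ! : ℝ) * γ * zeta2 D γ

end LongRange

end

/-! The range of the interaction is enlarged by a fixed factor `η` at a time, and only operators on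
one site are followed: `SiteBound` with prefactor 9, decay rate `2 / ℓ` and a velocity. Passing from
`ℓ` to `η ℓ` adds terms of strength at most `g ℓ ^ (-α + D)` per site. It suffices that the
prefactor stays fixed and that the velocity grows by a multiple of `ℓ ^ (-κ)`, since these
increments form a convergent geometric series.

For one step, `norm_lie_heis_le` interpolates between the evolutions by `H` and `H'`. The new terms
near the light cone of `A` enter through their commutators with `B` only, because the rest of their
effect is a norm-preserving rotation. The new terms outside the light cone see only the tail of the
evolved `A`, which `exists_shell_decomposition` cuts into local pieces of exponentially small norm.
Both contributions are controlled by commutators evolved with `H'` itself, so `LocalBound.improve`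
is an inequality of the unknown with itself. It is a contraction, and `LocalBound.of_contraction`
removes the crude, volume-dependent initial bound.

The price of a step is a growth rate `lam`, proportional to the coupling times the volume reached
during a time of order `1 / lam`. With lengths of order `ℓ ^ (1 + κ)`, the self-consistency
condition is `(1 + κ) (D + 1 + 2 κ) ≤ α - D`, solvable with `κ > 0` exactly because `α > 2 D + 1`.
The velocity then increases by `lam` times `η ℓ / 2`.

Prefactors do not accumulate: interpolating the bound with the trivial bound 2
(`SiteBound.norm_lie_heis_le_rpow`) lowers the rate to `2 / (η ℓ)` at the same velocity and replaces
the prefactor by its power `1 / η`. Operators on larger sets are recovered by averaging over signed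
permutations at each site, which bounds a commutator by a sum over sites (`norm_lie_le_sum_site`).
-/

open scoped Matrix.Norms.L2Operator Nat

noncomputable section

namespace LongRange

/-! ### Heisenberg evolution in a C⋆-algebra -/

section Abstract

set_option linter.unusedSectionVars false

open Filter Topology Set

variable {𝔸 : Type*} [NormedRing 𝔸] [StarRing 𝔸] [CStarRing 𝔸] [NormedAlgebra ℂ 𝔸]
  [StarModule ℂ 𝔸] [CompleteSpace 𝔸]

/-- The propagator `e^{iAt}`. -/
def propagator (A : 𝔸) (t : ℝ) : 𝔸 := NormedSpace.exp ((Complex.I * (t : ℂ)) • A)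

/-- The time evolution `e^{iAt} O e^{-iAt}`. -/
def heis (A O : 𝔸) (t : ℝ) : 𝔸 :=
  NormedSpace.exp ((Complex.I * (t : ℂ)) • A) * O * NormedSpace.exp (-((Complex.I * (t : ℂ)) • A))

lemma heis_eq (A O : 𝔸) (t : ℝ) : heis A O t = propagator A t * O * propagator A (-t) := by
  simp [heis, propagator]

lemma propagator_add (A : 𝔸) (s t : ℝ) :
    propagator A (s + t) = propagator A s * propagator A t := by
  let _ : NormedAlgebra ℚ 𝔸 := NormedAlgebra.restrictScalars ℚ ℂ 𝔸
  rw [propagator, propagator, propagator, ← NormedSpace.exp_add_of_commute, ← add_smul]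
  · push_cast; ring_nf
  · exact ((Commute.refl A).smul_left _).smul_right _

@[simp] lemma propagator_zero (A : 𝔸) : propagator A 0 = 1 := by simp [propagator]

@[simp] lemma propagator_neg_mul (A : 𝔸) (t : ℝ) : propagator A (-t) * propagator A t = 1 := by
  rw [← propagator_add]; simp

@[simp] lemma propagator_mul_neg (A : 𝔸) (t : ℝ) : propagator A t * propagator A (-t) = 1 := by
  rw [← propagator_add]; simp

lemma star_propagator {A : 𝔸} (hA : IsSelfAdjoint A) (t : ℝ) :
    star (propagator A t) = propagator A (-t) := by
  rw [propagator, propagator, NormedSpace.star_exp, star_smul, hA.star_eq]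
  simp

lemma propagator_mem_unitary {A : 𝔸} (hA : IsSelfAdjoint A) (t : ℝ) :
    propagator A t ∈ unitary 𝔸 := by
  rw [Unitary.mem_iff, star_propagator hA]; simp

lemma norm_heis {A : 𝔸} (hA : IsSelfAdjoint A) (O : 𝔸) (t : ℝ) : ‖heis A O t‖ = ‖O‖ := by
  rw [heis_eq, CStarRing.norm_mul_mem_unitary _ (propagator_mem_unitary hA _),
    CStarRing.norm_mem_unitary_mul _ (propagator_mem_unitary hA _)]

lemma heis_mul (A O O' : 𝔸) (t : ℝ) : heis A (O * O') t = heis A O t * heis A O' t := by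
  simp only [heis_eq]
  calc _ = propagator A t * O * 1 * O' * propagator A (-t) := by simp [mul_assoc]
    _ = _ := by rw [← propagator_neg_mul A t]; simp only [mul_assoc]

lemma heis_add (A O O' : 𝔸) (t : ℝ) : heis A (O + O') t = heis A O t + heis A O' t := by
  simp only [heis, mul_add, add_mul]

lemma heis_sub (A O O' : 𝔸) (t : ℝ) : heis A (O - O') t = heis A O t - heis A O' t := by
  simp only [heis, mul_sub, sub_mul]

lemma heis_smul (A O : 𝔸) (c : ℂ) (t : ℝ) : heis A (c • O) t = c • heis A O t := by
  simp [heis]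

lemma heis_sum {ι : Type*} (s : Finset ι) (A : 𝔸) (O : ι → 𝔸) (t : ℝ) :
    heis A (∑ i ∈ s, O i) t = ∑ i ∈ s, heis A (O i) t := by
  simp only [heis, Finset.mul_sum, Finset.sum_mul]

lemma heis_lie (A O O' : 𝔸) (t : ℝ) : heis A ⁅O, O'⁆ t = ⁅heis A O t, heis A O' t⁆ := by
  simp only [Ring.lie_def, heis_sub, heis_mul]

@[simp] lemma heis_zero_time (A O : 𝔸) : heis A O 0 = O := by simp [heis]

lemma heis_neg_left (A O : 𝔸) (t : ℝ) : heis (-A) O t = heis A O (-t) := by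
  simp [heis]

lemma heis_heis (A O : 𝔸) (s t : ℝ) : heis A (heis A O s) t = heis A O (t + s) := by
  simp only [heis_eq, propagator_add, neg_add_rev, mul_assoc]

lemma isSelfAdjoint_heis {A O : 𝔸} (hA : IsSelfAdjoint A) (hO : IsSelfAdjoint O) (t : ℝ) :
    IsSelfAdjoint (heis A O t) := by
  rw [IsSelfAdjoint, heis_eq, star_mul, star_mul, star_propagator hA, star_propagator hA,
    hO.star_eq, neg_neg, mul_assoc]

lemma norm_lie_le (A B : 𝔸) : ‖⁅A, B⁆‖ ≤ 2 * ‖A‖ * ‖B‖ := by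
  rw [Ring.lie_def]
  calc _ ≤ ‖A * B‖ + ‖B * A‖ := norm_sub_le _ _
    _ ≤ ‖A‖ * ‖B‖ + ‖B‖ * ‖A‖ := add_le_add (norm_mul_le _ _) (norm_mul_le _ _)
    _ = _ := by ring

lemma norm_lie_heis {A : 𝔸} (hA : IsSelfAdjoint A) (O B : 𝔸) (t : ℝ) :
    ‖⁅heis A O t, B⁆‖ = ‖⁅O, heis A B (-t)⁆‖ := by
  rw [← norm_heis hA ⁅O, _⁆ t, heis_lie, heis_heis]; simp

/-! ### Heisenberg equation and comparison of two evolutions. -/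

lemma hasDerivAt_propagator (A : 𝔸) (t : ℝ) :
    HasDerivAt (propagator A) (propagator A t * (Complex.I • A)) t := by
  have h := hasDerivAt_exp_smul_const (𝕂 := ℝ) (Complex.I • A) t
  have e : ∀ u : ℝ, NormedSpace.exp (u • Complex.I • A) = propagator A u := by
    intro u
    rw [propagator, ← Complex.coe_smul, smul_smul, mul_comm]
  simpa only [e] using h

lemma hasDerivAt_propagator' (A : 𝔸) (t : ℝ) :
    HasDerivAt (propagator A) ((Complex.I • A) * propagator A t) t := by
  have h := hasDerivAt_exp_smul_const' (𝕂 := ℝ) (Complex.I • A) t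
  have e : ∀ u : ℝ, NormedSpace.exp (u • Complex.I • A) = propagator A u := by
    intro u
    rw [propagator, ← Complex.coe_smul, smul_smul, mul_comm]
  simpa only [e] using h

/-- Heisenberg equation for a time-dependent observable. -/
lemma hasDerivAt_heis (A : 𝔸) {f : ℝ → 𝔸} {f' : 𝔸} {t : ℝ} (hf : HasDerivAt f f' t) :
    HasDerivAt (fun s => heis A (f s) s) (heis A (Complex.I • ⁅A, f t⁆ + f') t) t := by
  simp only [heis_eq]
  have h1 := hasDerivAt_propagator A t
  have h2 : HasDerivAt (fun s => propagator A (-s)) (-((Complex.I • A) * propagator A (-t))) t := by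
    have := (hasDerivAt_propagator' A (-t)).scomp t (hasDerivAt_neg t)
    rw [neg_one_smul] at this
    exact this
  refine ((h1.mul hf).mul h2).congr_deriv ?_
  simp only [Pi.mul_apply, Ring.lie_def, mul_add, add_mul, smul_sub, mul_sub, sub_mul, mul_neg,
    smul_mul_assoc, mul_smul_comm, mul_assoc]
  abel

/-- Derivative of the interpolation between two evolutions. -/
lemma hasDerivAt_interpolation (H H' A : 𝔸) (t s : ℝ) :
    HasDerivAt (fun s => heis H' (heis H A (t - s)) s)
      (heis H' (Complex.I • ⁅H' - H, heis H A (t - s)⁆) s) s := by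
  have h0 : HasDerivAt (fun s => heis H A s) (heis H (Complex.I • ⁅H, A⁆ + 0) (t - s)) (t - s) :=
    hasDerivAt_heis H (hasDerivAt_const _ A)
  have h1 := h0.scomp s ((hasDerivAt_id s).const_sub t)
  have h2 := hasDerivAt_heis H' h1
  have hH : heis H H (t - s) = H := by
    have hc : Commute (propagator H (t - s)) H := by
      refine Commute.exp_left ?_
      exact (Commute.refl H).smul_left _
    rw [heis_eq, hc.eq, mul_assoc, propagator_mul_neg, mul_one]
  have e : heis H (Complex.I • ⁅H, A⁆ + 0) (t - s) = Complex.I • ⁅H, heis H A (t - s)⁆ := by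
    rw [add_zero, heis_smul, heis_lie, hH]
  refine h2.congr_deriv ?_
  rw [e, neg_one_smul]
  congr 1
  simp only [Function.comp_apply, Ring.lie_def, sub_mul, mul_sub, smul_sub]
  abel

/-- A commutator term with a self-adjoint generator does not increase the norm. -/
lemma norm_le_of_hasDerivAt_lie {D G : ℝ → 𝔸} {K : ℝ → 𝔸} {b b' : ℝ → ℝ} {t : ℝ} (ht : 0 ≤ t)
    (hD : ∀ s, HasDerivAt D (Complex.I • ⁅K s, D s⁆ + G s) s)
    (hK : ∀ s, IsSelfAdjoint (K s))
    (hb : ∀ s, HasDerivAt b (b' s) s)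
    (hG : ∀ s ∈ Ico 0 t, ‖G s‖ ≤ b' s) :
    ‖D t‖ ≤ ‖D 0‖ + (b t - b 0) := by
  have key := image_le_of_liminf_slope_right_le_deriv_boundary (f := fun s => ‖D s‖)
    (a := 0) (b := t) (B := fun s => ‖D 0‖ + (b s - b 0)) (B' := b')
    (fun s _ => (hD s).continuousAt.norm.continuousWithinAt) (by simp)
    (fun s _ => ((continuousAt_const.add ((hb s).continuousAt.sub
      continuousAt_const))).continuousWithinAt)
    (fun s _ => by
      simpa using (((hb s).sub_const (b 0)).const_add ‖D 0‖).hasDerivWithinAt) ?_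
  · exact key ⟨ht, le_rfl⟩
  · intro s hs r hr
    -- The evolution generated by the frozen `K s` has the same commutator as derivative at `z = s`
    -- and constant norm, so subtracting it leaves only `G s`. No regularity of `K` in time is
    -- needed, so the near part may later be chosen separately at each time.
    have hE : HasDerivAt (fun z => heis (K s) (D s) (z - s)) (Complex.I • ⁅K s, D s⁆) s := by
      have h0 := hasDerivAt_heis (K s) (hasDerivAt_const (s - s) (D s))
      have h1 := HasDerivAt.scomp s (h := fun z => z - s) h0 ((hasDerivAt_id' s).sub_const s)
      rw [one_smul, add_zero, sub_self, heis_zero_time] at h1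
      exact h1
    have hd := ((hD s).sub hE).hasDerivWithinAt (s := Ici s)
    have hle : ‖Complex.I • ⁅K s, D s⁆ + G s - Complex.I • ⁅K s, D s⁆‖ < r := by
      rw [add_sub_cancel_left]
      exact (hG s hs).trans_lt hr
    refine ((hd.liminf_right_norm_slope_le hle).and_eventually self_mem_nhdsWithin).mono ?_
    rintro z ⟨hz, hzs⟩
    have hzs : 0 < z - s := sub_pos.2 hzs
    rw [slope_def_field, div_eq_inv_mul]
    refine lt_of_le_of_lt ?_ hz
    rw [Real.norm_of_nonneg hzs.le]
    gcongr
    have h3 : ‖heis (K s) (D s) (z - s)‖ = ‖D s‖ := norm_heis (hK s) _ _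
    have h4 := norm_sub_norm_le (D z) (heis (K s) (D s) (z - s))
    simpa [h3] using h4

/-- Comparison of the commutators of two evolutions.  At each time the part `W s` of the
perturbation is treated by norm conservation, the remaining part by its commutator with the
unperturbed evolution. -/
theorem norm_lie_heis_le {H H' A B : 𝔸} (hH : IsSelfAdjoint H) (hH' : IsSelfAdjoint H')
    {W : ℝ → 𝔸} (hW : ∀ s, IsSelfAdjoint (W s)) {b b' : ℝ → ℝ} {t : ℝ} (ht : 0 ≤ t)
    (hb : ∀ s, HasDerivAt b (b' s) s)
    (hbound : ∀ s ∈ Ico 0 t, 2 * ‖A‖ * ‖⁅heis H' (W s) s, B⁆‖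
      + ‖⁅heis H' ⁅H' - H - W s, heis H A (t - s)⁆ s, B⁆‖ ≤ b' s) :
    ‖⁅heis H' A t, B⁆‖ ≤ ‖⁅heis H A t, B⁆‖ + (b t - b 0) := by
  set C : ℝ → 𝔸 := fun s => heis H' (heis H A (t - s)) s with hC
  have hCn : ∀ s, ‖C s‖ = ‖A‖ := fun s => by rw [hC]; simp only [norm_heis hH', norm_heis hH]
  -- By the Jacobi identity `⁅⁅W, C⁆, B⁆ = ⁅W, ⁅C, B⁆⁆ + ⁅⁅W, B⁆, C⁆`. The first summand rotates
  -- `⁅C, B⁆` and costs nothing; in the second, `‖C‖ = ‖A‖`.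
  have h := norm_le_of_hasDerivAt_lie (D := fun s => ⁅C s, B⁆)
    (K := fun s => heis H' (W s) s)
    (G := fun s => Complex.I • (⁅⁅heis H' (W s) s, B⁆, C s⁆
      + ⁅heis H' ⁅H' - H - W s, heis H A (t - s)⁆ s, B⁆)) (b := b) (b' := b') ht ?_ ?_ hb ?_
  · simpa [hC] using h
  · intro s
    have h1 := hasDerivAt_interpolation H H' A t s
    have h2 := (h1.mul_const B).sub (h1.const_mul B)
    have e : heis H' (Complex.I • ⁅H' - H, heis H A (t - s)⁆) s =
        Complex.I • (⁅heis H' (W s) s, C s⁆ + heis H' ⁅H' - H - W s, heis H A (t - s)⁆ s) := by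
      rw [heis_smul, hC, ← heis_lie, ← heis_add]
      simp only [Ring.lie_def, sub_mul, mul_sub]
      congr 2
      abel
    rw [e] at h2
    refine h2.congr_deriv ?_
    simp only [Ring.lie_def, smul_add, smul_sub, mul_add, add_mul, mul_sub, sub_mul,
      smul_mul_assoc, mul_smul_comm, mul_assoc]
    abel
  · exact fun s => isSelfAdjoint_heis hH' (hW s) s
  · intro s hs
    refine le_trans ?_ (hbound s hs)
    rw [norm_smul, Complex.norm_I, one_mul]
    refine (norm_add_le _ _).trans (add_le_add ?_ le_rfl)
    refine (norm_lie_le _ _).trans (le_of_eq ?_)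
    rw [hCn]; ring

end Abstract

lemma evolve_eq_heis {V : Type*} [Fintype V] [DecidableEq V] {d : V → ℕ} (A O : Op d) (t : ℝ) :
    evolve A O t = heis A O t := rfl

/-! ### Supports of operators -/

section Supports

variable {V : Type*} [Fintype V] [DecidableEq V] {d : V → ℕ}

lemma SupportedOn.commute {A B : Op d} {X Y : Finset V} (hA : SupportedOn A X)
    (hB : SupportedOn B Y) (hXY : Disjoint X Y) : Commute A B := by
  obtain ⟨a, ha⟩ := hA
  obtain ⟨b, hb⟩ := hB
  have hdis : ∀ i, i ∈ X → i ∉ Y := fun i hi => Finset.disjoint_left.1 hXY hi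
  ext s s'
  -- Each product has at most one contributing intermediate configuration: `u` for `A * B` and `u'`
  -- for `B * A`.
  set u : (i : V) → Fin (d i) := fun i => if i ∈ X then s' i else s i with hu
  set u' : (i : V) → Fin (d i) := fun i => if i ∈ X then s i else s' i with hu'
  have h1 : (A * B) s s' = A s u * B u s' := by
    rw [Matrix.mul_apply]
    refine Finset.sum_eq_single u (fun w _ hw => ?_) (by simp)
    by_contra hne
    refine hw (funext fun i => ?_)
    rw [hu]
    by_cases hi : i ∈ X
    · simp only [hi, if_true]
      by_contra hni
      exact hne (by rw [(hb w s').2 ⟨i, hdis i hi, hni⟩, mul_zero])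
    · simp only [hi, if_false]
      by_contra hni
      exact hne (by rw [(ha s w).2 ⟨i, hi, Ne.symm hni⟩, zero_mul])
  have h2 : (B * A) s s' = B s u' * A u' s' := by
    rw [Matrix.mul_apply]
    refine Finset.sum_eq_single u' (fun w _ hw => ?_) (by simp)
    by_contra hne
    refine hw (funext fun i => ?_)
    rw [hu']
    by_cases hi : i ∈ X
    · simp only [hi, if_true]
      by_contra hni
      exact hne (by rw [(hb s w).2 ⟨i, hdis i hi, Ne.symm hni⟩, zero_mul])
    · simp only [hi, if_false]
      by_contra hni
      exact hne (by rw [(ha w s').2 ⟨i, hi, hni⟩, mul_zero])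
  rw [h1, h2, (ha s u).1 (fun i hi => by simp [hu, hi]),
    (ha u' s').1 (fun i hi => by simp [hu', hi])]
  have e1 : (fun i : X => u i) = fun i : X => s' i := by funext i; simp [hu]
  have e2 : (fun i : X => u' i) = fun i : X => s i := by funext i; simp [hu']
  have e3 : B u s' = B s u' := by
    by_cases h : ∃ i, i ∉ Y ∧ u i ≠ s' i
    · rw [(hb u s').2 h]
      obtain ⟨i, hiY, hi⟩ := h
      refine ((hb s u').2 ⟨i, hiY, ?_⟩).symm
      by_cases hiX : i ∈ X <;> simp_all
    · push Not at h
      have e : ∀ i, i ∉ Y → s i = u' i := by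
        intro i hi
        have := h i hi
        by_cases hiX : i ∈ X <;> simp_all
      rw [(hb u s').1 h, (hb s u').1 e]
      congr 1 <;> funext i
      · have : (i : V) ∉ X := fun hX => hdis _ hX i.2
        simp [hu, this]
      · have : (i : V) ∉ X := fun hX => hdis _ hX i.2
        simp [hu', this]
  rw [e1, e2, e3, mul_comm]

/-- The matrix unit `|a⟩⟨b|` at the site `k`. -/
def siteUnit (k : V) (a b : Fin (d k)) : Op d :=
  fun s s' => if s' k = b ∧ s = Function.update s' k a then 1 else 0

lemma supportedOn_siteUnit (k : V) (a b : Fin (d k)) :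
    SupportedOn (siteUnit k a b : Op d) {k} := by
  refine ⟨fun σ σ' => if σ' ⟨k, by simp⟩ = b ∧ σ ⟨k, by simp⟩ = a then 1 else 0,
    fun s s' => ⟨fun h => ?_, fun ⟨i, hi, hne⟩ => ?_⟩⟩
  · have : s = Function.update s' k a ↔ s k = a := by
      refine ⟨fun h => by rw [h]; simp, fun hk => funext fun i => ?_⟩
      by_cases hi : i = k
      · subst hi; simpa using hk
      · rw [Function.update_of_ne hi]; exact h i (by simpa using hi)
    simp only [siteUnit, this]
  · rw [siteUnit, if_neg]
    rintro ⟨-, h⟩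
    rw [Finset.mem_singleton] at hi
    exact hne (by rw [h, Function.update_of_ne hi])

lemma mul_siteUnit_apply (A : Op d) (k : V) (a b : Fin (d k)) (s s' : (i : V) → Fin (d i)) :
    (A * siteUnit k a b) s s' = if s' k = b then A s (Function.update s' k a) else 0 := by
  rw [Matrix.mul_apply, Finset.sum_eq_single (Function.update s' k a)]
  · by_cases h : s' k = b <;> simp [siteUnit, h]
  · intro w _ hw
    simp [siteUnit, hw]
  · simp

lemma siteUnit_mul_apply (A : Op d) (k : V) (a b : Fin (d k)) (s s' : (i : V) → Fin (d i)) :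
    (siteUnit k a b * A) s s' = if s k = a then A (Function.update s k b) s' else 0 := by
  rw [Matrix.mul_apply, Finset.sum_eq_single (Function.update s k b)]
  · by_cases h : s k = a
    · have : Function.update (Function.update s k b) k a = s := by
        rw [Function.update_idem, ← h, Function.update_eq_self]
      simp [siteUnit, h]
    · have : ¬ s = Function.update (Function.update s k b) k a := by
        intro h'; apply h; rw [h']; simp
      rw [siteUnit, if_neg (fun h' => this h'.2), zero_mul, if_neg h]
  · intro w _ hw
    rw [siteUnit, if_neg, zero_mul]
    rintro ⟨h1, h2⟩
    apply hw
    rw [h2, Function.update_idem, ← h1, Function.update_eq_self]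
  · simp

/-- Spins outside `X` can be moved one at a time to a reference configuration, on which the local
matrix is read off. Positive dimensions provide that configuration. -/
lemma supportedOn_of_entries (hd : ∀ i, 0 < d i) {A : Op d} {X : Finset V}
    (h0 : ∀ k ∉ X, ∀ s s', s k ≠ s' k → A s s' = 0)
    (h1 : ∀ k ∉ X, ∀ s s' c, s k = s' k →
      A (Function.update s k c) (Function.update s' k c) = A s s') : SupportedOn A X := by
  set z : (i : V) → Fin (d i) := fun i => ⟨0, hd i⟩
  set glue : ((i : X) → Fin (d i)) → (i : V) → Fin (d i) :=
    fun σ i => if hi : i ∈ X then σ ⟨i, hi⟩ else z i with hglue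
  refine ⟨fun σ σ' => A (glue σ) (glue σ'), fun s s' => ⟨fun h => ?_, fun ⟨i, hi, hne⟩ =>
    h0 i hi s s' hne⟩⟩
  have key : ∀ T : Finset V, Disjoint T X →
      A (T.piecewise z s) (T.piecewise z s') = A s s' := by
    intro T
    induction T using Finset.induction_on with
    | empty => simp
    | insert j T hj ih =>
      intro hT
      rw [Finset.disjoint_insert_left] at hT
      rw [Finset.piecewise_insert, Finset.piecewise_insert, h1 j hT.1, ih hT.2]
      simp [Finset.piecewise, hj, h j hT.1]
  have hg : ∀ r : (i : V) → Fin (d i), glue (fun i => r i) = (Xᶜ).piecewise z r := by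
    intro r
    funext i
    by_cases hi : i ∈ X <;> simp [hglue, Finset.piecewise, hi]
  change A s s' = A (glue fun i => s i) (glue fun i => s' i)
  rw [hg, hg, key _ disjoint_compl_left]

/-- Commuting with the matrix units at `k` forces an operator to be the identity in the factor at
`k`. Support thus becomes a commutant condition, from which its stability under algebraic operations
is immediate. -/
lemma supportedOn_of_commute (hd : ∀ i, 0 < d i) {A : Op d} {X : Finset V}
    (h : ∀ k ∉ X, ∀ C : Op d, SupportedOn C {k} → Commute A C) : SupportedOn A X := by
  have e : ∀ k ∉ X, ∀ a b (s s' : (i : V) → Fin (d i)),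
      (if s' k = b then A s (Function.update s' k a) else 0)
        = if s k = a then A (Function.update s k b) s' else 0 := by
    intro k hk a b s s'
    rw [← mul_siteUnit_apply, ← siteUnit_mul_apply, (h k hk _ (supportedOn_siteUnit k a b)).eq]
  refine supportedOn_of_entries hd (fun k hk s s' hne => ?_) (fun k hk s s' c hs => ?_)
  · have := e k hk (s' k) (s' k) s s'
    simpa [hne] using this
  · have := e k hk (s k) c s (Function.update s' k c)
    simp only [Function.update_self, if_true, Function.update_idem] at this
    rw [← this, hs, Function.update_eq_self]

lemma SupportedOn.commute_site {A C : Op d} {X : Finset V} {k : V} (hA : SupportedOn A X)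
    (hk : k ∉ X) (hC : SupportedOn C {k}) : Commute A C :=
  hA.commute hC (by simpa using hk)

lemma SupportedOn.mono (hd : ∀ i, 0 < d i) {A : Op d} {X Y : Finset V} (hA : SupportedOn A X)
    (h : X ⊆ Y) : SupportedOn A Y :=
  supportedOn_of_commute hd fun _ hk _ hC => hA.commute_site (fun hX => hk (h hX)) hC

lemma SupportedOn.mul (hd : ∀ i, 0 < d i) {A B : Op d} {X : Finset V} (hA : SupportedOn A X)
    (hB : SupportedOn B X) : SupportedOn (A * B) X :=
  supportedOn_of_commute hd fun _ hk _ hC =>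
    (hA.commute_site hk hC).mul_left (hB.commute_site hk hC)

lemma SupportedOn.sub (hd : ∀ i, 0 < d i) {A B : Op d} {X : Finset V} (hA : SupportedOn A X)
    (hB : SupportedOn B X) : SupportedOn (A - B) X :=
  supportedOn_of_commute hd fun _ hk _ hC =>
    (hA.commute_site hk hC).sub_left (hB.commute_site hk hC)

lemma SupportedOn.lie (hd : ∀ i, 0 < d i) {A B : Op d} {X : Finset V} (hA : SupportedOn A X)
    (hB : SupportedOn B X) : SupportedOn ⁅A, B⁆ X := by
  rw [Ring.lie_def]
  exact (hA.mul hd hB).sub hd (hB.mul hd hA)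

lemma SupportedOn.neg (hd : ∀ i, 0 < d i) {A : Op d} {X : Finset V} (hA : SupportedOn A X) :
    SupportedOn (-A) X :=
  supportedOn_of_commute hd fun _ hk _ hC => (hA.commute_site hk hC).neg_left

lemma SupportedOn.sum (hd : ∀ i, 0 < d i) {ι : Type*} {T : Finset ι} {A : ι → Op d}
    {X : Finset V} (hA : ∀ i ∈ T, SupportedOn (A i) X) : SupportedOn (∑ i ∈ T, A i) X :=
  supportedOn_of_commute hd fun _ hk _ hC =>
    Commute.sum_left _ _ _ fun i hi => (hA i hi).commute_site hk hC

/-! ### Site averages and approximation by local operators. -/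

/-- `B` commutes up to `c` with the operators of norm at most one at the site `k`. -/
def SiteCommLE (B : Op d) (k : V) (c : ℝ) : Prop :=
  ∀ u : Op d, SupportedOn u {k} → ‖u‖ ≤ 1 → ‖⁅u, B⁆‖ ≤ c

/-- A signed permutation of the basis states at the site `k`. -/
def signedPerm (k : V) (p : (Fin (d k) → ℤˣ) × Equiv.Perm (Fin (d k))) : Op d :=
  fun s u => if u = Function.update s k (p.2 (s k)) then ((p.1 (s k) : ℤ) : ℂ) else 0

lemma supportedOn_signedPerm (k : V) (p : (Fin (d k) → ℤˣ) × Equiv.Perm (Fin (d k))) :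
    SupportedOn (signedPerm k p : Op d) {k} := by
  refine ⟨fun σ σ' => if σ' ⟨k, by simp⟩ = p.2 (σ ⟨k, by simp⟩) then
    ((p.1 (σ ⟨k, by simp⟩) : ℤ) : ℂ) else 0, fun s s' => ⟨fun h => ?_, fun ⟨i, hi, hne⟩ => ?_⟩⟩
  · have : s' = Function.update s k (p.2 (s k)) ↔ s' k = p.2 (s k) := by
      refine ⟨fun h => by rw [h]; simp, fun hk => funext fun i => ?_⟩
      by_cases hi : i = k
      · subst hi; simpa using hk
      · rw [Function.update_of_ne hi]; exact (h i (by simpa using hi)).symm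
    simp only [signedPerm, this]
  · rw [signedPerm, if_neg]
    intro h
    rw [Finset.mem_singleton] at hi
    exact hne (by rw [h, Function.update_of_ne hi])

lemma signedPerm_mul_apply (k : V) (p : (Fin (d k) → ℤˣ) × Equiv.Perm (Fin (d k))) (B : Op d)
    (s s' : (i : V) → Fin (d i)) :
    (signedPerm k p * B) s s'
      = ((p.1 (s k) : ℤ) : ℂ) * B (Function.update s k (p.2 (s k))) s' := by
  rw [Matrix.mul_apply, Finset.sum_eq_single (Function.update s k (p.2 (s k)))]
  · simp [signedPerm]
  · intro w _ hw
    simp [signedPerm, hw]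
  · simp

lemma mul_star_signedPerm_apply (k : V) (p : (Fin (d k) → ℤˣ) × Equiv.Perm (Fin (d k)))
    (B : Op d) (s s' : (i : V) → Fin (d i)) :
    (B * star (signedPerm k p)) s s'
      = B s (Function.update s' k (p.2 (s' k))) * ((p.1 (s' k) : ℤ) : ℂ) := by
  rw [Matrix.mul_apply, Finset.sum_eq_single (Function.update s' k (p.2 (s' k)))]
  · simp [signedPerm, Matrix.star_apply]
  · intro w _ hw
    simp [signedPerm, hw, Matrix.star_apply]
  · simp

lemma signedPerm_mem_unitary (k : V) (p : (Fin (d k) → ℤˣ) × Equiv.Perm (Fin (d k))) :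
    (signedPerm k p : Op d) ∈ unitary (Op d) := by
  have h : (signedPerm k p : Op d) * star (signedPerm k p) = 1 := by
    ext s s'
    rw [mul_star_signedPerm_apply, signedPerm, Matrix.one_apply]
    by_cases h : s = s'
    · subst h
      have : ((p.1 (s k) : ℤ) : ℂ) * ((p.1 (s k) : ℤ) : ℂ) = 1 := by
        rw [← Int.cast_mul, ← Units.val_mul, Int.units_mul_self]; simp
      simp [this]
    · rw [if_neg, if_neg h, zero_mul]
      intro h'
      apply h
      have hk : s' k = s k := p.2.injective (by simpa using congrFun h' k)
      funext i
      by_cases hi : i = k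
      · subst hi; exact hk.symm
      · simpa [Function.update_of_ne hi] using (congrFun h' i).symm
  rw [Unitary.mem_iff]
  exact ⟨mul_eq_one_comm.1 h, h⟩

/-- Averaging over the signed permutations at one site. -/
lemma exists_site_average (hd : ∀ i, 0 < d i) (B : Op d) (k : V) :
    ∃ B' : Op d, (∀ C : Op d, SupportedOn C {k} → Commute B' C) ∧
      (∀ c, SiteCommLE B k c → ‖B - B'‖ ≤ c) ∧
      (∀ j ≠ k, ∀ c, SiteCommLE B j c → SiteCommLE B' j c) ∧
      (∀ X, SupportedOn B X → SupportedOn B' (X.erase k)) := by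
  classical
  -- The signed permutations are a finite set of unitaries large enough for conjugation by them to
  -- average the site away, so no Haar measure is needed: the signs kill the off-diagonal blocks and
  -- the permutations equalise the diagonal ones.
  set P := (Fin (d k) → ℤˣ) × Equiv.Perm (Fin (d k)) with hP
  set N : ℕ := Fintype.card P with hN
  have hN0 : (N : ℂ) ≠ 0 := by simp [hN]
  have hN0' : (0 : ℝ) < N := by
    rw [hN]; exact_mod_cast Fintype.card_pos (α := P)
  set U : P → Op d := fun p => signedPerm k p with hU
  have hUu : ∀ p, U p ∈ unitary (Op d) := fun p => signedPerm_mem_unitary k p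
  have hUs : ∀ p, SupportedOn (U p) {k} := fun p => supportedOn_signedPerm k p
  have hUn : ∀ p, ‖U p‖ ≤ 1 := by
    intro p
    have := CStarRing.norm_mem_unitary_mul (1 : Op d) (hUu p)
    rw [mul_one] at this
    rw [this]
    have : Nonempty ((i : V) → Fin (d i)) := ⟨fun i => ⟨0, hd i⟩⟩
    exact (CStarRing.norm_one (E := Op d)).le
  have hUc : ∀ p (u : Op d), Commute u (U p) → Commute u (star (U p)) := by
    intro p u h
    have h1 := (Unitary.mem_iff.1 (hUu p)).1
    have h2 := (Unitary.mem_iff.1 (hUu p)).2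
    calc u * star (U p) = star (U p) * (U p * u) * star (U p) := by
          rw [← mul_assoc, h1, one_mul]
      _ = star (U p) * (u * U p) * star (U p) := by rw [h.eq]
      _ = star (U p) * u := by rw [mul_assoc, mul_assoc, h2, mul_one]
  set B' : Op d := (N : ℂ)⁻¹ • ∑ p, U p * B * star (U p) with hB'
  have hent : ∀ s s', B' s s' = (N : ℂ)⁻¹ * ∑ p : P, ((p.1 (s k) : ℤ) : ℂ) *
      B (Function.update s k (p.2 (s k))) (Function.update s' k (p.2 (s' k))) *
        ((p.1 (s' k) : ℤ) : ℂ) := by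
    intro s s'
    rw [hB', Matrix.smul_apply, Matrix.sum_apply, smul_eq_mul]
    congr 1
    refine Finset.sum_congr rfl fun p _ => ?_
    rw [mul_star_signedPerm_apply, signedPerm_mul_apply]
  have hsupp : SupportedOn B' (Finset.univ.erase k) := by
    refine supportedOn_of_entries hd (fun j hj s s' hne => ?_) (fun j hj s s' c hs => ?_)
    · obtain rfl : j = k := by simpa using hj
      rw [hent]
      refine mul_eq_zero_of_right _ ?_
      -- Reversing the sign of the single basis state `s j` permutes the summands and negates each
      -- of them.
      set δ : Fin (d j) → ℤˣ := Function.update 1 (s j) (-1) with hδ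
      have e := Equiv.sum_comp ((Equiv.mulRight δ).prodCongr (Equiv.refl _))
        (fun p : P => ((p.1 (s j) : ℤ) : ℂ) *
          B (Function.update s j (p.2 (s j))) (Function.update s' j (p.2 (s' j))) *
            ((p.1 (s' j) : ℤ) : ℂ))
      rw [← self_eq_neg, ← Finset.sum_neg_distrib, ← e]
      refine Finset.sum_congr rfl fun p _ => ?_
      simp [hδ, Function.update_of_ne (Ne.symm hne)]
    · obtain rfl : j = k := by simpa using hj
      rw [hent, hent]
      congr 1
      rw [← Equiv.sum_comp ((Equiv.refl _).prodCongr (Equiv.mulRight (Equiv.swap (s j) c)))]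
      refine Finset.sum_congr rfl fun p _ => ?_
      have hsq : ∀ x : ℤˣ, ∀ y : ℂ, ((x : ℤ) : ℂ) * y * ((x : ℤ) : ℂ) = y := by
        intro x y
        rw [mul_right_comm, ← Int.cast_mul, ← Units.val_mul, Int.units_mul_self]; simp
      simp [← hs, hsq]
  have hcomm : ∀ C : Op d, SupportedOn C {k} → Commute B' C :=
    fun C hC => hsupp.commute_site (by simp) hC
  refine ⟨B', hcomm, ?_, ?_, ?_⟩
  · intro c hc
    have e : B - B' = (N : ℂ)⁻¹ • ∑ p, (B - U p * B * star (U p)) := by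
      rw [Finset.sum_sub_distrib, smul_sub, hB', Finset.sum_const, Finset.card_univ, ← hN,
        ← Nat.cast_smul_eq_nsmul ℂ, smul_smul, inv_mul_cancel₀ hN0, one_smul]
    have h1 : ∀ p, ‖B - U p * B * star (U p)‖ ≤ c := by
      intro p
      refine le_trans (le_of_eq ?_) (hc (U p) (hUs p) (hUn p))
      rw [← CStarRing.norm_mul_mem_unitary ⁅U p, B⁆ (Unitary.star_mem (hUu p)), Ring.lie_def,
        sub_mul, mul_assoc B, (Unitary.mem_iff.1 (hUu p)).2, mul_one, norm_sub_rev]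
    rw [e, norm_smul]
    calc _ ≤ ‖(N : ℂ)⁻¹‖ * ∑ p : P, c := by
          gcongr
          exact norm_sum_le_of_le _ fun p _ => h1 p
      _ = c := by
          rw [Finset.sum_const, Finset.card_univ, ← hN, nsmul_eq_mul, norm_inv,
            Complex.norm_natCast, inv_mul_cancel_left₀ hN0'.ne']
  · intro j hj c hc u hu hu1
    have huU : ∀ p, Commute u (U p) := fun p =>
      hu.commute (hUs p) (by simpa using hj)
    have e : ⁅u, B'⁆ = (N : ℂ)⁻¹ • ∑ p, U p * ⁅u, B⁆ * star (U p) := by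
      rw [hB', Ring.lie_def, mul_smul_comm, smul_mul_assoc, ← smul_sub, Finset.mul_sum,
        Finset.sum_mul, ← Finset.sum_sub_distrib]
      congr 1
      refine Finset.sum_congr rfl fun p _ => ?_
      rw [Ring.lie_def, mul_sub, sub_mul, ← mul_assoc, ← mul_assoc, (huU p).eq,
        mul_assoc (U p * B), ← (hUc p u (huU p)).eq]
      simp only [mul_assoc]
    rw [e, norm_smul]
    calc _ ≤ ‖(N : ℂ)⁻¹‖ * ∑ p : P, c := by
          gcongr
          refine norm_sum_le_of_le _ fun p _ => ?_
          rw [CStarRing.norm_mul_mem_unitary _ (Unitary.star_mem (hUu p)),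
            CStarRing.norm_mem_unitary_mul _ (hUu p)]
          exact hc u hu hu1
      _ = c := by
          rw [Finset.sum_const, Finset.card_univ, ← hN, nsmul_eq_mul, norm_inv,
            Complex.norm_natCast, inv_mul_cancel_left₀ hN0'.ne']
  · intro X hX
    refine supportedOn_of_commute hd fun j hj C hC => ?_
    by_cases hjk : j = k
    · subst hjk; exact hcomm C hC
    · have hjX : j ∉ X := fun h => hj (Finset.mem_erase.2 ⟨hjk, h⟩)
      have h1 : ∀ p, Commute C (U p) := fun p => hC.commute (hUs p) (by simpa using hjk)
      refine Commute.smul_left (Commute.sum_left _ _ _ fun p _ => ?_) _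
      exact (((h1 p).symm.mul_left (hX.commute_site hjX hC)).mul_left (hUc p C (h1 p)).symm)

lemma SiteCommLE.nonneg {B : Op d} {k : V} {c : ℝ} (h : SiteCommLE B k c) : 0 ≤ c := by
  have h1 : SupportedOn (0 : Op d) {k} := ⟨0, fun s s' => ⟨fun _ => rfl, fun _ => rfl⟩⟩
  exact (norm_nonneg _).trans (h 0 h1 (by simp))

/-- Averaging over the signed permutations at the sites of `T`. -/
lemma exists_average (hd : ∀ i, 0 < d i) (B : Op d) (c : V → ℝ) (T : Finset V)
    (hc : ∀ k, SiteCommLE B k (c k)) :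
    ∃ B' : Op d, (∀ k ∈ T, ∀ C : Op d, SupportedOn C {k} → Commute B' C) ∧
      ‖B - B'‖ ≤ ∑ k ∈ T, c k ∧ (∀ k, SiteCommLE B' k (c k)) ∧
      (∀ X, SupportedOn B X → SupportedOn B' (X \ T)) := by
  induction T using Finset.induction_on with
  | empty => exact ⟨B, by simp, by simp, hc, by simp⟩
  | insert j T hj ih =>
    obtain ⟨B₁, h1, h2, h3, h4⟩ := ih
    -- Averaging at `j` keeps the commutator bounds at all other sites, so the costs `c k` simply
    -- add.
    obtain ⟨B₂, g1, g2, g3, g4⟩ := exists_site_average hd B₁ j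
    have hsup : ∀ X, SupportedOn B X → SupportedOn B₂ (X \ insert j T) := by
      intro X hX
      rw [Finset.sdiff_insert]
      exact g4 _ (h4 X hX)
    have huniv : SupportedOn B Finset.univ :=
      supportedOn_of_commute hd fun k hk => absurd (Finset.mem_univ k) hk
    have hcom : ∀ k ∈ insert j T, ∀ C : Op d, SupportedOn C {k} → Commute B₂ C :=
      fun k hk C hC => (hsup _ huniv).commute_site (by simp [Finset.mem_insert.1 hk]) hC
    refine ⟨B₂, hcom, ?_, fun k => ?_, hsup⟩
    · rw [Finset.sum_insert hj]
      calc ‖B - B₂‖ = ‖(B₁ - B₂) + (B - B₁)‖ := by congr 1; abel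
        _ ≤ ‖B₁ - B₂‖ + ‖B - B₁‖ := norm_add_le _ _
        _ ≤ _ := add_le_add (g2 _ (h3 j)) h2
    · by_cases hk : k = j
      · subst hk
        intro u hu _
        rw [Ring.lie_def, (g1 u hu).eq, sub_self, norm_zero]
        exact (h3 k).nonneg
      · exact g3 k hk _ (h3 k)

/-- The commutator with an operator on `X` is bounded by the sum over the sites of `X`. -/
lemma norm_lie_le_sum_site (hd : ∀ i, 0 < d i) {A B : Op d} {X : Finset V}
    (hA : SupportedOn A X) {c : V → ℝ} (hc : ∀ k, SiteCommLE B k (c k)) :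
    ‖⁅A, B⁆‖ ≤ 2 * ‖A‖ * ∑ k ∈ X, c k := by
  obtain ⟨B', h1, h2, -, h4⟩ := exists_average hd B c X hc
  have huniv : SupportedOn B Finset.univ :=
    supportedOn_of_commute hd fun k hk => absurd (Finset.mem_univ k) hk
  have hcom : Commute A B' := hA.commute (h4 _ huniv) Finset.disjoint_sdiff
  have e : ⁅A, B⁆ = ⁅A, B - B'⁆ := by
    simp only [Ring.lie_def, mul_sub, sub_mul, hcom.eq]; abel
  rw [e]
  exact (norm_lie_le _ _).trans (by gcongr)

/-- Decomposition of an operator into pieces supported on the sublevel sets of `r`. -/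
lemma exists_shell_decomposition (hd : ∀ i, 0 < d i) (A : Op d) (c : V → ℝ)
    (hc : ∀ k, SiteCommLE A k (c k)) (r : V → ℕ) (m : ℕ) :
    ∃ (N : ℕ) (A₀ : Op d) (Δ : ℕ → Op d),
      SupportedOn A₀ (Finset.univ.filter fun k => r k ≤ m) ∧
      (∀ n ∈ Finset.Ioc m N, SupportedOn (Δ n) (Finset.univ.filter fun k => r k ≤ n)) ∧
      (∀ n ∈ Finset.Ioc m N, ‖Δ n‖ ≤ ∑ k ∈ Finset.univ.filter fun k => r k = n, c k) ∧
      A = A₀ + ∑ n ∈ Finset.Ioc m N, Δ n := by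
  have huniv : SupportedOn A Finset.univ :=
    supportedOn_of_commute hd fun k hk => absurd (Finset.mem_univ k) hk
  -- All sites satisfy `r k ≤ N`. The shells are averaged out from `N` down to `m + 1`, and `Δ n` is
  -- what the average over the shell `r k = n` removes.
  set N := m + Finset.univ.sup r with hN
  have main : ∀ j ≤ N - m, ∃ (A₀ : Op d) (Δ : ℕ → Op d),
      SupportedOn A₀ (Finset.univ.filter fun k => r k ≤ N - j) ∧
      (∀ k, SiteCommLE A₀ k (c k)) ∧
      (∀ n ∈ Finset.Ioc (N - j) N, SupportedOn (Δ n) (Finset.univ.filter fun k => r k ≤ n)) ∧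
      (∀ n ∈ Finset.Ioc (N - j) N,
        ‖Δ n‖ ≤ ∑ k ∈ Finset.univ.filter fun k => r k = n, c k) ∧
      A = A₀ + ∑ n ∈ Finset.Ioc (N - j) N, Δ n := by
    intro j
    induction j with
    | zero =>
      intro _
      refine ⟨A, fun _ => 0, huniv.mono hd fun k _ => ?_, hc, by simp, by simp, by simp⟩
      have := Finset.le_sup (f := r) (Finset.mem_univ k)
      simp only [Finset.mem_filter, Finset.mem_univ, true_and]
      omega
    | succ j ih =>
      intro hj
      obtain ⟨A₀, Δ, h1, h2, h3, h4, h5⟩ := ih (by omega)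
      obtain ⟨A₁, g1, g2, g3, g4⟩ :=
        exists_average hd A₀ c (Finset.univ.filter fun k => r k = N - j) h2
      have hs1 : SupportedOn A₁ (Finset.univ.filter fun k => r k ≤ N - (j + 1)) := by
        refine (g4 _ h1).mono hd fun k hk => ?_
        simp only [Finset.mem_sdiff, Finset.mem_filter, Finset.mem_univ, true_and] at hk ⊢
        omega
      have hioc : Finset.Ioc (N - (j + 1)) N = insert (N - j) (Finset.Ioc (N - j) N) := by
        ext n
        simp only [Finset.mem_Ioc, Finset.mem_insert]
        omega
      have hmem : ∀ n ∈ Finset.Ioc (N - j) N, n ≠ N - j := by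
        intro n hn
        rw [Finset.mem_Ioc] at hn
        omega
      refine ⟨A₁, Function.update Δ (N - j) (A₀ - A₁), hs1, g3, ?_, ?_, ?_⟩
      · intro n hn
        rw [hioc, Finset.mem_insert] at hn
        rcases eq_or_ne n (N - j) with rfl | hne
        · rw [Function.update_self]
          refine h1.sub hd (hs1.mono hd fun k hk => ?_)
          simp only [Finset.mem_filter, Finset.mem_univ, true_and] at hk ⊢
          omega
        · rw [Function.update_of_ne hne]
          exact h3 n (hn.resolve_left hne)
      · intro n hn
        rw [hioc, Finset.mem_insert] at hn
        rcases eq_or_ne n (N - j) with rfl | hne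
        · rw [Function.update_self]
          exact g2
        · rw [Function.update_of_ne hne]
          exact h4 n (hn.resolve_left hne)
      · rw [hioc, Finset.sum_insert (by simp), Function.update_self,
          Finset.sum_congr rfl fun n hn => Function.update_of_ne (hmem n hn) _ _]
        nth_rewrite 1 [h5]
        abel
  obtain ⟨A₀, Δ, h1, -, h3, h4, h5⟩ := main (N - m) le_rfl
  have hm : N - (N - m) = m := by omega
  rw [hm] at h1 h3 h4 h5
  exact ⟨N, A₀, Δ, h1, h3, h4, h5⟩

end Supports

/-! ### Distances and volumes -/

section Distances

set_option linter.unusedSectionVars false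

variable {V : Type*} [Fintype V] [DecidableEq V] {G : SimpleGraph V}

lemma setDist_le_dist {X Y : Finset V} {i j : V} (hi : i ∈ X) (hj : j ∈ Y) :
    setDist G X Y ≤ G.dist i j :=
  Nat.sInf_le ⟨i, hi, j, hj, rfl⟩

lemma exists_dist_eq_setDist {X Y : Finset V} (hX : X.Nonempty) (hY : Y.Nonempty) :
    ∃ i ∈ X, ∃ j ∈ Y, G.dist i j = setDist G X Y := by
  obtain ⟨i, hi⟩ := hX
  obtain ⟨j, hj⟩ := hY
  exact Nat.sInf_mem (s := {n : ℕ | ∃ i ∈ X, ∃ j ∈ Y, G.dist i j = n}) ⟨_, i, hi, j, hj, rfl⟩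

lemma setDist_singleton_anti {X Y : Finset V} {k : V} (hk : k ∈ X) (hY : Y.Nonempty) :
    setDist G X Y ≤ setDist G {k} Y := by
  obtain ⟨i, hi, j, hj, h⟩ := exists_dist_eq_setDist (G := G) (Finset.singleton_nonempty k) hY
  rw [Finset.mem_singleton] at hi
  rw [← h, hi]
  exact setDist_le_dist hk hj

lemma dist_lt_diam {X : Finset V} {i j : V} (hi : i ∈ X) (hj : j ∈ X) :
    G.dist i j + 1 ≤ diam G X := by
  have h1 : (X.sup fun j => G.dist i j) ≤ X.sup fun i => X.sup fun j => G.dist i j :=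
    Finset.le_sup (f := fun i => X.sup fun j => G.dist i j) hi
  have h2 : G.dist i j ≤ X.sup fun j => G.dist i j := Finset.le_sup (f := fun j => G.dist i j) hj
  unfold diam
  omega

@[simp] lemma diam_singleton (k : V) : diam G {k} = 1 := by simp [diam]

lemma mem_extend {X : Finset V} {r : ℝ} {k : V} :
    k ∈ extend G X r ↔ ∃ i ∈ X, (G.dist i k : ℝ) ≤ r := by simp [extend]

lemma setDist_singleton_le_iff {X : Finset V} (hX : X.Nonempty) {k : V} {n : ℕ} :
    setDist G {k} X ≤ n ↔ k ∈ extend G X n := by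
  rw [mem_extend]
  constructor
  · intro h
    obtain ⟨i, hi, j, hj, e⟩ := exists_dist_eq_setDist (G := G) (Finset.singleton_nonempty k) hX
    rw [Finset.mem_singleton] at hi
    subst hi
    refine ⟨j, hj, ?_⟩
    rw [SimpleGraph.dist_comm]
    exact_mod_cast e.trans_le h
  · rintro ⟨i, hi, h⟩
    rw [SimpleGraph.dist_comm] at h
    exact (setDist_le_dist (Finset.mem_singleton_self k) hi).trans (by exact_mod_cast h)

lemma filter_setDist_eq_extend {X : Finset V} (hX : X.Nonempty) (n : ℕ) :
    (Finset.univ.filter fun k => setDist G {k} X ≤ n) = extend G X n := by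
  ext k
  rw [← setDist_singleton_le_iff hX]; simp

lemma setDist_le_of_mem_extend (hG : G.Connected) {X Y : Finset V} (hY : Y.Nonempty) {r : ℝ}
    {k : V} (hk : k ∈ extend G X r) : (setDist G X Y : ℝ) ≤ r + setDist G {k} Y := by
  obtain ⟨i, hi, h⟩ := mem_extend.1 hk
  obtain ⟨k', hk', j, hj, e⟩ := exists_dist_eq_setDist (G := G) (Finset.singleton_nonempty k) hY
  rw [Finset.mem_singleton] at hk'
  subst hk'
  have h1 : setDist G X Y ≤ G.dist i k' + G.dist k' j :=
    (setDist_le_dist hi hj).trans hG.dist_triangle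
  have h2 : (setDist G X Y : ℝ) ≤ G.dist i k' + G.dist k' j := by exact_mod_cast h1
  rw [← e]
  linarith

lemma subset_extend_of_mem (hG : G.Connected) {X Z : Finset V} {r : ℝ} {k : V} (hkZ : k ∈ Z)
    (hk : k ∈ extend G X r) : Z ⊆ extend G X (r + diam G Z) := by
  intro j hj
  obtain ⟨i, hi, h⟩ := mem_extend.1 hk
  refine mem_extend.2 ⟨i, hi, ?_⟩
  have h1 : G.dist i j ≤ G.dist i k + G.dist k j := hG.dist_triangle
  have h2 := dist_lt_diam (G := G) hkZ hj
  have h3 : (G.dist i j : ℝ) ≤ G.dist i k + G.dist k j := by exact_mod_cast h1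
  have h4 : (G.dist k j : ℝ) + 1 ≤ diam G Z := by exact_mod_cast h2
  linarith

lemma extend_mono {X : Finset V} {r r' : ℝ} (h : r ≤ r') : extend G X r ⊆ extend G X r' := by
  intro k hk
  obtain ⟨i, hi, h'⟩ := mem_extend.1 hk
  exact mem_extend.2 ⟨i, hi, h'.trans h⟩

lemma setDist_le_of_inter (hG : G.Connected) {X Y Z : Finset V} (hY : Y.Nonempty) {r : ℝ} {k : V}
    (hkZ : k ∈ Z) (hk : k ∈ extend G X r) :
    (setDist G X Y : ℝ) ≤ r + diam G Z + setDist G Z Y := by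
  obtain ⟨z, hz, j, hj, e⟩ := exists_dist_eq_setDist (G := G) ⟨k, hkZ⟩ hY
  have h1 := setDist_le_of_mem_extend hG hY (subset_extend_of_mem hG hkZ hk hz)
  have h2 : setDist G {z} Y ≤ setDist G Z Y := by
    rw [← e]; exact setDist_le_dist (Finset.mem_singleton_self z) hj
  have h3 : (setDist G {z} Y : ℝ) ≤ setDist G Z Y := by exact_mod_cast h2
  linarith

lemma IsLattice.card_extend_le {D : ℕ} {γ : ℝ} (hG : IsLattice G D γ) (hγ : 1 ≤ γ)
    {X : Finset V} {ℓ r : ℝ} (hX : (diam G X : ℝ) ≤ ℓ) (hr : 0 ≤ r) :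
    ((extend G X r).card : ℝ) ≤ γ * (2 * (r + ℓ)) ^ D := by
  have h1 : (1 : ℝ) ≤ diam G X := by
    have : 1 ≤ diam G X := by unfold diam; omega
    exact_mod_cast this
  rcases X.eq_empty_or_nonempty with rfl | ⟨i, hi⟩
  · have : extend G ∅ r = ∅ := by ext k; simp [mem_extend]
    rw [this, Finset.card_empty, Nat.cast_zero]
    have : 0 ≤ r + ℓ := by linarith
    positivity
  · refine le_trans ?_ (hG.card_ball_le i (r + ℓ) (by linarith))
    have : extend G X r ⊆ extend G {i} (r + ℓ) := by
      intro k hk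
      obtain ⟨j, hj, h⟩ := mem_extend.1 hk
      refine mem_extend.2 ⟨i, Finset.mem_singleton_self i, ?_⟩
      have h2 : G.dist i k ≤ G.dist i j + G.dist j k := hG.connected.dist_triangle
      have h3 := dist_lt_diam (G := G) hi hj
      have h4 : (G.dist i k : ℝ) ≤ G.dist i j + G.dist j k := by exact_mod_cast h2
      have h5 : (G.dist i j : ℝ) + 1 ≤ diam G X := by exact_mod_cast h3
      linarith
    exact_mod_cast Finset.card_le_card this

end Distances

/-! ### The bound for operators at one site -/

section Step

variable {V : Type*} [Fintype V] [DecidableEq V] {G : SimpleGraph V} {d : V → ℕ}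

/-- Lieb–Robinson bound for the evolution of operators at one site. -/
def SiteBound (G : SimpleGraph V) (H : Op d) (P μ v : ℝ) : Prop :=
  ∀ (k : V) (Y : Finset V), Y.Nonempty → ∀ A B : Op d, SupportedOn A {k} → SupportedOn B Y →
    ∀ t : ℝ, ‖⁅heis H A t, B⁆‖
      ≤ ‖A‖ * ‖B‖ * (P * Real.exp (-(μ * setDist G {k} Y) + μ * v * |t|))

lemma SiteBound.neg {H : Op d} {P μ v : ℝ} (h : SiteBound G H P μ v) : SiteBound G (-H) P μ v := by
  intro k Y hY A B hA hB t
  rw [heis_neg_left, ← abs_neg t]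
  exact h k Y hY A B hA hB (-t)

/-- Moving the evolution from the site operator onto `B` turns the Lieb–Robinson bound into
approximate locality of the evolved `B`. -/
lemma siteCommLE_heis {H : Op d} (hH : IsSelfAdjoint H) {P μ v : ℝ} (hP : 0 ≤ P)
    (h : SiteBound G H P μ v) {B : Op d} {Y : Finset V} (hY : Y.Nonempty) (hB : SupportedOn B Y)
    (k : V) (t : ℝ) :
    SiteCommLE (heis H B t) k
      (‖B‖ * (P * Real.exp (-(μ * setDist G {k} Y) + μ * v * |t|))) := by
  intro u hu hu1
  have h1 := norm_lie_heis hH u B (-t)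
  rw [neg_neg] at h1
  rw [← h1]
  refine (h k Y hY u B hu hB (-t)).trans ?_
  rw [abs_neg, mul_assoc]
  exact mul_le_of_le_one_left (by positivity) hu1

/-- The bound for operators on a set, as a sum over its sites. -/
lemma SiteBound.norm_lie_heis_le (hd : ∀ i, 0 < d i) {H : Op d} (hH : IsSelfAdjoint H)
    {P μ v : ℝ} (hP : 0 ≤ P) (hμ : 0 ≤ μ) (h : SiteBound G H P μ v) {A B : Op d} {X Y : Finset V}
    (hY : Y.Nonempty) (hA : SupportedOn A X) (hB : SupportedOn B Y) (t : ℝ) :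
    ‖⁅heis H A t, B⁆‖ ≤ 2 * ‖A‖ * ‖B‖ *
      (P * X.card * Real.exp (-(μ * setDist G X Y) + μ * v * |t|)) := by
  rw [norm_lie_heis hH]
  refine (norm_lie_le_sum_site hd hA fun k => siteCommLE_heis hH hP h hY hB k (-t)).trans ?_
  have : ∑ k ∈ X, ‖B‖ * (P * Real.exp (-(μ * setDist G {k} Y) + μ * v * |-t|))
      ≤ ∑ k ∈ X, ‖B‖ * (P * Real.exp (-(μ * setDist G X Y) + μ * v * |t|)) := by
    refine Finset.sum_le_sum fun k hk => ?_
    rw [abs_neg]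
    have := setDist_singleton_anti (G := G) hk hY
    gcongr
  calc _ ≤ 2 * ‖A‖ * ∑ k ∈ X, ‖B‖ * (P * Real.exp (-(μ * setDist G X Y) + μ * v * |t|)) := by
        gcongr
    _ = _ := by rw [Finset.sum_const, nsmul_eq_mul]; ring

/-- This is `min 1 z ≤ z ^ θ`. The rate drops by the factor `θ`, the velocity is unchanged, and the
cardinality of `X` enters only to the power `θ`. -/
lemma SiteBound.norm_lie_heis_le_rpow (hd : ∀ i, 0 < d i) {H : Op d} (hH : IsSelfAdjoint H)
    {P μ v θ : ℝ} (hP : 0 ≤ P) (hμ : 0 ≤ μ) (hθ : 0 ≤ θ) (hθ1 : θ ≤ 1) (h : SiteBound G H P μ v)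
    {A B : Op d} {X Y : Finset V} (hY : Y.Nonempty) (hA : SupportedOn A X) (hB : SupportedOn B Y)
    (t : ℝ) :
    ‖⁅heis H A t, B⁆‖ ≤ 2 * ‖A‖ * ‖B‖ *
      ((P * X.card) ^ θ * Real.exp (-(θ * μ * setDist G X Y) + θ * μ * v * |t|)) := by
  have h1 := h.norm_lie_heis_le hd hH hP hμ hY hA hB t
  have h2 : ‖⁅heis H A t, B⁆‖ ≤ 2 * ‖A‖ * ‖B‖ := by
    have := norm_lie_le (heis H A t) B
    rwa [norm_heis hH] at this
  set z := P * X.card * Real.exp (-(μ * setDist G X Y) + μ * v * |t|) with hz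
  have hz0 : 0 ≤ z := by positivity
  have e : (P * X.card) ^ θ * Real.exp (-(θ * μ * setDist G X Y) + θ * μ * v * |t|) = z ^ θ := by
    rw [hz, Real.mul_rpow (by positivity) (Real.exp_pos _).le, ← Real.exp_mul]
    congr 2; ring
  rw [e]
  rcases le_total 1 z with hz1 | hz1
  · refine h2.trans (le_mul_of_one_le_right (by positivity) (Real.one_le_rpow hz1 hθ))
  · refine h1.trans (mul_le_mul_of_nonneg_left ?_ (by positivity))
    rcases hz0.eq_or_lt with h0 | h0
    · rw [← h0]; exact Real.rpow_nonneg le_rfl _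
    · simpa using Real.rpow_le_rpow_of_exponent_ge h0 hz1 hθ1

open Classical in
lemma sum_norm_meeting_le {h : Finset V → Op d} {𝒵 : Finset (Finset V)} {J : ℝ}
    (hJ : ∀ i, ∑ Z ∈ 𝒵.filter (fun Z => i ∈ Z), ‖h Z‖ ≤ J) (S : Finset V) :
    ∑ Z ∈ 𝒵.filter (fun Z => ∃ k ∈ Z, k ∈ S), ‖h Z‖ ≤ S.card * J := by
  calc _ ≤ ∑ Z ∈ 𝒵.filter (fun Z => ∃ k ∈ Z, k ∈ S), ∑ i ∈ S, if i ∈ Z then ‖h Z‖ else 0 := by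
        refine Finset.sum_le_sum fun Z hZ => ?_
        obtain ⟨k, hkZ, hkS⟩ := (Finset.mem_filter.1 hZ).2
        refine le_trans ?_ (Finset.single_le_sum (f := fun i => if i ∈ Z then ‖h Z‖ else 0)
          (fun i _ => by positivity) hkS)
        simp [hkZ]
    _ ≤ ∑ Z ∈ 𝒵, ∑ i ∈ S, if i ∈ Z then ‖h Z‖ else 0 :=
        Finset.sum_le_sum_of_subset_of_nonneg (Finset.filter_subset _ _)
          fun _ _ _ => Finset.sum_nonneg fun i _ => by positivity
    _ = ∑ i ∈ S, ∑ Z ∈ 𝒵.filter (fun Z => i ∈ Z), ‖h Z‖ := by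
        rw [Finset.sum_comm]
        exact Finset.sum_congr rfl fun i _ => (Finset.sum_filter _ _).symm
    _ ≤ _ := by
        refine (Finset.sum_le_sum fun i _ => hJ i).trans (le_of_eq ?_)
        rw [Finset.sum_const, nsmul_eq_mul]

end Step

/-! ### Adding longer-range terms: the self-consistent bound. -/

section Perturbation

variable {V : Type*} [Fintype V] [DecidableEq V] {G : SimpleGraph V} {d : V → ℕ}

open Classical in
/-- Interaction terms of range at most `ℓ` and strength at most `J` per site. -/
structure IsPerturbation (G : SimpleGraph V) (h : Finset V → Op d) (𝒵 : Finset (Finset V))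
    (ℓ J : ℝ) : Prop where
  isSelfAdjoint : ∀ Z ∈ 𝒵, IsSelfAdjoint (h Z)
  supportedOn : ∀ Z ∈ 𝒵, SupportedOn (h Z) Z
  diam_le : ∀ Z ∈ 𝒵, (diam G Z : ℝ) ≤ ℓ
  sum_le : ∀ i, ∑ Z ∈ 𝒵.filter (fun Z => i ∈ Z), ‖h Z‖ ≤ J

lemma IsPerturbation.neg (hd : ∀ i, 0 < d i) {h : Finset V → Op d} {𝒵 : Finset (Finset V)}
    {ℓ J : ℝ} (hp : IsPerturbation G h 𝒵 ℓ J) : IsPerturbation G (-h) 𝒵 ℓ J where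
  isSelfAdjoint Z hZ := (hp.isSelfAdjoint Z hZ).neg
  supportedOn Z hZ := (hp.supportedOn Z hZ).neg hd
  diam_le := hp.diam_le
  sum_le i := by simpa using hp.sum_le i

/-- The evolution of the operators on sets of diameter at most `ℓ` commutes with `B` up to an
error that decays with the distance to `Y`. -/
def LocalBound (G : SimpleGraph V) (H B : Op d) (Y : Finset V) (ℓ M μ ν : ℝ) : Prop :=
  ∀ X : Finset V, X.Nonempty → (diam G X : ℝ) ≤ ℓ → ∀ A : Op d, SupportedOn A X →
    ∀ t : ℝ, 0 ≤ t →
      ‖⁅heis H A t, B⁆‖ ≤ ‖A‖ * (M * Real.exp (-(μ * setDist G X Y) + ν * t))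

variable {h : Finset V → Op d} {𝒵 : Finset (Finset V)} {ℓ J M μ ν : ℝ} {H' B : Op d}
  {X Y : Finset V}

-- A term meeting `X[r]` is at most `r + ℓ` closer to `Y` than `X` is, and its diameter allows the
-- local bound for `H'` to be applied to it directly.
open Classical in
lemma norm_lie_near_le (hG : G.Connected) (hp : IsPerturbation G h 𝒵 ℓ J) (hM0 : 0 ≤ M)
    (hμ : 0 ≤ μ) (hM : LocalBound G H' B Y ℓ M μ ν) (hY : Y.Nonempty) (r : ℝ) {s : ℝ}
    (hs : 0 ≤ s) :
    ‖⁅heis H' (∑ Z ∈ 𝒵.filter (fun Z => ∃ k ∈ Z, k ∈ extend G X r), h Z) s, B⁆‖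
      ≤ (extend G X r).card * J *
        (M * Real.exp (-(μ * setDist G X Y) + μ * (r + ℓ) + ν * s)) := by
  have e : ⁅heis H' (∑ Z ∈ 𝒵.filter (fun Z => ∃ k ∈ Z, k ∈ extend G X r), h Z) s, B⁆
      = ∑ Z ∈ 𝒵.filter (fun Z => ∃ k ∈ Z, k ∈ extend G X r), ⁅heis H' (h Z) s, B⁆ := by
    simp only [heis_sum, Ring.lie_def, Finset.sum_mul, Finset.mul_sum, Finset.sum_sub_distrib]
  rw [e]
  refine (norm_sum_le_of_le (f := fun Z => ⁅heis H' (h Z) s, B⁆) _ (n := fun Z => ‖h Z‖ *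
    (M * Real.exp (-(μ * setDist G X Y) + μ * (r + ℓ) + ν * s))) fun Z hZ => ?_).trans ?_
  · obtain ⟨hZ, k, hkZ, hk⟩ := Finset.mem_filter.1 hZ
    refine (hM Z ⟨k, hkZ⟩ (hp.diam_le Z hZ) _ (hp.supportedOn Z hZ) s hs).trans ?_
    have h1 := setDist_le_of_inter hG hY hkZ hk
    have h2 := hp.diam_le Z hZ
    have h3 : μ * setDist G X Y ≤ μ * (r + ℓ) + μ * setDist G Z Y := by
      rw [← mul_add]; exact mul_le_mul_of_nonneg_left (by linarith) hμ
    gcongr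
    linarith
  · rw [← Finset.sum_mul]
    exact mul_le_mul_of_nonneg_right (sum_norm_meeting_le hp.sum_le _) (by positivity)

-- Only terms meeting the support of `Δ` matter. The inner commutator lives on `X[r + ℓ]`, whose
-- diameter may be too large for the local bound, so the single-site bounds are summed instead. The
-- two commutator estimates give the factor 4.
open Classical in
lemma norm_lie_far_le (hd : ∀ i, 0 < d i) (hG : G.Connected) (hp : IsPerturbation G h 𝒵 ℓ J)
    (hJ : 0 ≤ J) (hM0 : 0 ≤ M) (hμ : 0 ≤ μ) (hℓ : 1 ≤ ℓ) (hH' : IsSelfAdjoint H')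
    (hM : LocalBound G H' B Y ℓ M μ ν)
    (hY : Y.Nonempty) {𝒵' : Finset (Finset V)} (h𝒵 : 𝒵' ⊆ 𝒵) {r : ℝ} {Δ : Op d}
    (hΔ : SupportedOn Δ (extend G X r)) {s : ℝ} (hs : 0 ≤ s) :
    ‖⁅heis H' ⁅∑ Z ∈ 𝒵', h Z, Δ⁆ s, B⁆‖
      ≤ 4 * ‖Δ‖ * ((extend G X r).card * J) * (extend G X (r + ℓ)).card *
        (M * Real.exp (-(μ * setDist G X Y) + μ * (r + ℓ) + ν * s)) := by
  set 𝒴 := 𝒵'.filter (fun Z => ∃ k ∈ Z, k ∈ extend G X r) with h𝒴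
  have e : ⁅∑ Z ∈ 𝒵', h Z, Δ⁆ = ⁅∑ Z ∈ 𝒴, h Z, Δ⁆ := by
    simp only [Ring.lie_def, Finset.sum_mul, Finset.mul_sum, ← Finset.sum_sub_distrib]
    refine (Finset.sum_filter_of_ne fun Z hZ hne => ?_).symm
    by_contra hcon
    push Not at hcon
    refine hne (sub_eq_zero.2 ?_)
    exact (hp.supportedOn Z (h𝒵 hZ)).commute hΔ (Finset.disjoint_left.2 hcon)
  have hn : ‖∑ Z ∈ 𝒴, h Z‖ ≤ (extend G X r).card * J := by
    refine (norm_sum_le _ _).trans (le_trans ?_ (sum_norm_meeting_le hp.sum_le _))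
    exact Finset.sum_le_sum_of_subset_of_nonneg (Finset.filter_subset_filter _ h𝒵)
      fun _ _ _ => norm_nonneg _
  have hsup : SupportedOn ⁅∑ Z ∈ 𝒴, h Z, Δ⁆ (extend G X (r + ℓ)) := by
    refine (SupportedOn.sum hd fun Z hZ => ?_).lie hd (hΔ.mono hd (extend_mono (by linarith)))
    obtain ⟨hZ, k, hkZ, hk⟩ := Finset.mem_filter.1 hZ
    refine (hp.supportedOn Z (h𝒵 hZ)).mono hd ((subset_extend_of_mem hG hkZ hk).trans ?_)
    have := hp.diam_le Z (h𝒵 hZ)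
    exact extend_mono (by linarith)
  have hsite : ∀ k, SiteCommLE (heis H' B (-s)) k
      (M * Real.exp (-(μ * setDist G {k} Y) + ν * s)) := by
    intro k u hu hu1
    rw [← norm_lie_heis hH']
    refine (hM {k} (Finset.singleton_nonempty k) (by simpa using hℓ) u hu s hs).trans ?_
    exact mul_le_of_le_one_left (by positivity) hu1
  rw [e, norm_lie_heis hH']
  refine (norm_lie_le_sum_site hd hsup hsite).trans ?_
  have h1 : ∑ k ∈ extend G X (r + ℓ), M * Real.exp (-(μ * setDist G {k} Y) + ν * s)
      ≤ (extend G X (r + ℓ)).card *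
        (M * Real.exp (-(μ * setDist G X Y) + μ * (r + ℓ) + ν * s)) := by
    rw [← nsmul_eq_mul]
    refine Finset.sum_le_card_nsmul _ _ _ fun k hk => ?_
    have h3 : μ * setDist G X Y ≤ μ * (r + ℓ) + μ * setDist G {k} Y := by
      rw [← mul_add]
      exact mul_le_mul_of_nonneg_left (setDist_le_of_mem_extend hG hY hk) hμ
    gcongr
    linarith
  have h2 : ‖⁅∑ Z ∈ 𝒴, h Z, Δ⁆‖ ≤ 2 * ((extend G X r).card * J) * ‖Δ‖ :=
    (norm_lie_le _ _).trans (by gcongr)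
  calc _ ≤ 2 * (2 * ((extend G X r).card * J) * ‖Δ‖) * ((extend G X (r + ℓ)).card *
        (M * Real.exp (-(μ * setDist G X Y) + μ * (r + ℓ) + ν * s))) := by gcongr
    _ = _ := by ring

/-- Volume bound for the `r`-neighbourhood of a set of diameter at most `ℓ`. -/
def nbhdVol (D : ℕ) (γ ℓ r : ℝ) : ℝ := γ * (2 * (r + ℓ)) ^ D

lemma nbhdVol_nonneg {D : ℕ} {γ ℓ r : ℝ} (hγ : 1 ≤ γ) (hr : 0 ≤ r) (hℓ : 1 ≤ ℓ) :
    0 ≤ nbhdVol D γ ℓ r := by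
  unfold nbhdVol; positivity

lemma nbhdVol_mono {D : ℕ} {γ ℓ r r' : ℝ} (hγ : 1 ≤ γ) (hr : 0 ≤ r) (hℓ : 1 ≤ ℓ) (h : r ≤ r') :
    nbhdVol D γ ℓ r ≤ nbhdVol D γ ℓ r' := by
  unfold nbhdVol; gcongr

open Classical in
/-- Bound on the source term in the comparison of the evolutions by `H` and by `H'`, for the
elapsed time `u`. -/
lemma exists_near_part (hd : ∀ i, 0 < d i) {D : ℕ} {γ : ℝ} (hL : IsLattice G D γ) (hγ : 1 ≤ γ)
    (hp : IsPerturbation G h 𝒵 ℓ J) (hJ : 0 ≤ J) (hM0 : 0 ≤ M) (hμ : 0 ≤ μ) (hℓ : 1 ≤ ℓ)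
    {H : Op d} (hH : IsSelfAdjoint H) (hH'e : H' = H + ∑ Z ∈ 𝒵, h Z)
    (hH' : IsSelfAdjoint H') {P μ₀ v : ℝ} (hP : 0 ≤ P) (hS : SiteBound G H P μ₀ v)
    (hM : LocalBound G H' B Y ℓ M μ ν) (hX : X.Nonempty)
    (hXd : (diam G X : ℝ) ≤ ℓ) (hY : Y.Nonempty) {A : Op d} (hA : SupportedOn A X)
    {R u K : ℝ} (hu : 0 ≤ u) (hR : 0 ≤ R)
    (hnear : 2 * J * nbhdVol D γ ℓ R * Real.exp (μ * (R + ℓ)) ≤ K)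
    (hfar : ∀ m N : ℕ, R < m + 1 → ∑ n ∈ Finset.Ioc m N, 4 * J * P * nbhdVol D γ ℓ (n + ℓ) ^ 3 *
      Real.exp (-(μ₀ * (n - v * u))) * Real.exp (μ * (n + ℓ)) ≤ K) :
    ∃ W : Op d, IsSelfAdjoint W ∧ ∀ s, 0 ≤ s → 2 * ‖A‖ * ‖⁅heis H' W s, B⁆‖
      + ‖⁅heis H' ⁅H' - H - W, heis H A u⁆ s, B⁆‖
        ≤ ‖A‖ * (2 * K * M * Real.exp (-(μ * setDist G X Y) + ν * s)) := by
  set m := ⌊R⌋₊ with hm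
  have hmR : (m : ℝ) ≤ R := Nat.floor_le hR
  set 𝒩 := 𝒵.filter (fun Z => ∃ k ∈ Z, k ∈ extend G X m) with h𝒩
  set ℱ := 𝒵.filter (fun Z => ¬ ∃ k ∈ Z, k ∈ extend G X m) with hℱ
  have hsplit : H' - H - ∑ Z ∈ 𝒩, h Z = ∑ Z ∈ ℱ, h Z := by
    rw [hH'e, ← Finset.sum_filter_add_sum_filter_not 𝒵 (fun Z => ∃ k ∈ Z, k ∈ extend G X m)]
    abel
  -- Applied with `A` in the role of `B`, the bound for `H` shows that the evolved `A` almost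
  -- commutes with sites far from `X`; the shells are indexed by the distance to `X`.
  obtain ⟨N, A₀, Δ, hA₀, hΔs, hΔn, hAe⟩ := exists_shell_decomposition hd (heis H A u)
    (fun k => ‖A‖ * (P * Real.exp (-(μ₀ * setDist G {k} X) + μ₀ * v * |u|)))
    (fun k => siteCommLE_heis hH hP hS hX hA k u) (fun k => setDist G {k} X) m
  simp only [filter_setDist_eq_extend hX] at hA₀ hΔs
  refine ⟨∑ Z ∈ 𝒩, h Z, ?_, fun s hs => ?_⟩
  · exact isSelfAdjoint_sum _ fun Z hZ => hp.isSelfAdjoint Z (Finset.mem_filter.1 hZ).1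
  have hn : 2 * ‖A‖ * ‖⁅heis H' (∑ Z ∈ 𝒩, h Z) s, B⁆‖
      ≤ ‖A‖ * (K * M * Real.exp (-(μ * setDist G X Y) + ν * s)) := by
    have h1 := norm_lie_near_le (X := X) hL.connected hp hM0 hμ hM hY m hs
    have h2 : ((extend G X m).card : ℝ) ≤ nbhdVol D γ ℓ R :=
      (hL.card_extend_le hγ hXd (Nat.cast_nonneg m)).trans
        (nbhdVol_mono hγ (Nat.cast_nonneg m) hℓ hmR)
    calc _ ≤ 2 * ‖A‖ * (nbhdVol D γ ℓ R * J *
        (M * Real.exp (-(μ * setDist G X Y) + μ * (R + ℓ) + ν * s))) := by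
          have h3 : 0 ≤ nbhdVol D γ ℓ R := nbhdVol_nonneg hγ hR hℓ
          refine mul_le_mul_of_nonneg_left (h1.trans ?_) (by positivity)
          gcongr
      _ = ‖A‖ * ((2 * J * nbhdVol D γ ℓ R * Real.exp (μ * (R + ℓ))) * M *
          Real.exp (-(μ * setDist G X Y) + ν * s)) := by
          rw [show -(μ * (setDist G X Y : ℝ)) + μ * (R + ℓ) + ν * s
            = μ * (R + ℓ) + (-(μ * setDist G X Y) + ν * s) by ring, Real.exp_add]
          ring
      _ ≤ _ := by gcongr
  have hf : ‖⁅heis H' ⁅H' - H - ∑ Z ∈ 𝒩, h Z, heis H A u⁆ s, B⁆‖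
      ≤ ‖A‖ * (K * M * Real.exp (-(μ * setDist G X Y) + ν * s)) := by
    -- The core `A₀` lives on `X[m]`, which the far terms avoid; only the shells `Δ n` with `n > m`
    -- remain.
    have hcomm : Commute (∑ Z ∈ ℱ, h Z) A₀ := by
      refine Commute.sum_left _ _ _ fun Z hZ => ?_
      obtain ⟨hZ, hne⟩ := Finset.mem_filter.1 hZ
      push Not at hne
      exact (hp.supportedOn Z hZ).commute hA₀ (Finset.disjoint_left.2 hne)
    have e : ⁅heis H' ⁅∑ Z ∈ ℱ, h Z, heis H A u⁆ s, B⁆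
        = ∑ n ∈ Finset.Ioc m N, ⁅heis H' ⁅∑ Z ∈ ℱ, h Z, Δ n⁆ s, B⁆ := by
      have e1 : ⁅∑ Z ∈ ℱ, h Z, heis H A u⁆ = ∑ n ∈ Finset.Ioc m N, ⁅∑ Z ∈ ℱ, h Z, Δ n⁆ := by
        rw [hAe]
        generalize ∑ Z ∈ ℱ, h Z = F at hcomm
        simp only [Ring.lie_def, mul_add, add_mul, hcomm.eq, Finset.mul_sum, Finset.sum_mul,
          Finset.sum_sub_distrib]
        abel
      rw [e1, heis_sum]
      simp only [Ring.lie_def, Finset.mul_sum, Finset.sum_mul, Finset.sum_sub_distrib]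
    rw [hsplit, e]
    refine (norm_sum_le _ _).trans ?_
    have hterm : ∀ n ∈ Finset.Ioc m N, ‖⁅heis H' ⁅∑ Z ∈ ℱ, h Z, Δ n⁆ s, B⁆‖
        ≤ (4 * J * P * nbhdVol D γ ℓ (n + ℓ) ^ 3 *
          Real.exp (-(μ₀ * (n - v * u))) * Real.exp (μ * (n + ℓ))) *
          (‖A‖ * (M * Real.exp (-(μ * setDist G X Y) + ν * s))) := by
      intro n hn
      have hn0 : (0 : ℝ) ≤ n := Nat.cast_nonneg n
      have hv0 : 0 ≤ nbhdVol D γ ℓ (n + ℓ) := nbhdVol_nonneg hγ (by linarith) hℓ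
      have c1 : ((extend G X n).card : ℝ) ≤ nbhdVol D γ ℓ (n + ℓ) :=
        (hL.card_extend_le hγ hXd hn0).trans (nbhdVol_mono hγ hn0 hℓ (by linarith))
      have c2 : ((extend G X (n + ℓ)).card : ℝ) ≤ nbhdVol D γ ℓ (n + ℓ) :=
        hL.card_extend_le hγ hXd (by linarith)
      have hΔ : ‖Δ n‖ ≤ nbhdVol D γ ℓ (n + ℓ) *
          (‖A‖ * (P * Real.exp (-(μ₀ * (n - v * u))))) := by
        refine (hΔn n hn).trans ?_
        have : ∀ k ∈ Finset.univ.filter (fun k => setDist G {k} X = n),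
            ‖A‖ * (P * Real.exp (-(μ₀ * setDist G {k} X) + μ₀ * v * |u|))
              ≤ ‖A‖ * (P * Real.exp (-(μ₀ * (n - v * u)))) := by
          intro k hk
          rw [(Finset.mem_filter.1 hk).2, abs_of_nonneg hu]
          refine le_of_eq ?_
          congr 3; ring
        refine (Finset.sum_le_card_nsmul _ _ _ this).trans ?_
        rw [nsmul_eq_mul]
        refine mul_le_mul_of_nonneg_right (le_trans ?_ c1) (by positivity)
        rw [← filter_setDist_eq_extend hX]
        exact_mod_cast Finset.card_le_card
          (Finset.monotone_filter_right _ fun k _ hk => le_of_eq hk)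
      have h1 := norm_lie_far_le hd hL.connected hp hJ hM0 hμ hℓ hH' hM hY
        (Finset.filter_subset (fun Z => ¬ ∃ k ∈ Z, k ∈ extend G X m) 𝒵) (hΔs n hn) hs
      refine h1.trans ?_
      calc _ ≤ 4 * (nbhdVol D γ ℓ (n + ℓ) * (‖A‖ * (P * Real.exp (-(μ₀ * (n - v * u)))))) *
            (nbhdVol D γ ℓ (n + ℓ) * J) * nbhdVol D γ ℓ (n + ℓ) *
            (M * Real.exp (-(μ * setDist G X Y) + μ * (n + ℓ) + ν * s)) := by gcongr
        _ = _ := by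
          rw [show -(μ * (setDist G X Y : ℝ)) + μ * (n + ℓ) + ν * s
            = μ * (n + ℓ) + (-(μ * setDist G X Y) + ν * s) by ring,
            Real.exp_add (μ * (n + ℓ))]
          ring
    refine (Finset.sum_le_sum hterm).trans ?_
    rw [← Finset.sum_mul]
    calc _ ≤ K * (‖A‖ * (M * Real.exp (-(μ * setDist G X Y) + ν * s))) :=
          mul_le_mul_of_nonneg_right (hfar m N (Nat.lt_floor_add_one R)) (by positivity)
      _ = _ := by ring
  calc _ ≤ _ := add_le_add hn hf
    _ = _ := by ring

/-- Improvement of the local bound for the perturbed evolution. -/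
lemma LocalBound.improve (hd : ∀ i, 0 < d i) {D : ℕ} {γ : ℝ} (hL : IsLattice G D γ) (hγ : 1 ≤ γ)
    (hp : IsPerturbation G h 𝒵 ℓ J) (hJ : 0 ≤ J) (hM0 : 0 ≤ M) (hμ : 0 ≤ μ) (hℓ : 1 ≤ ℓ)
    {H : Op d} (hH : IsSelfAdjoint H) (hH'e : H' = H + ∑ Z ∈ 𝒵, h Z)
    (hH' : IsSelfAdjoint H') {P μ₀ v : ℝ} (hP : 0 ≤ P) (hv : 0 ≤ v) (hS : SiteBound G H P μ₀ v)
    {lam Q r₀ : ℝ} (hlam : 0 < lam) (hr₀ : 0 ≤ r₀) (hQ : 0 ≤ Q)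
    (hM : LocalBound G H' B Y ℓ M μ (μ * v + lam)) (hY : Y.Nonempty)
    (hnear : ∀ u, 0 ≤ u → 2 * J * nbhdVol D γ ℓ (v * u + r₀) *
      Real.exp (μ * (v * u + r₀ + ℓ)) ≤ Q * Real.exp ((μ * v + lam / 2) * u))
    (hfar : ∀ u, 0 ≤ u → ∀ m N : ℕ, v * u + r₀ < m + 1 → ∑ n ∈ Finset.Ioc m N, 4 * J * P *
      nbhdVol D γ ℓ (n + ℓ) ^ 3 * Real.exp (-(μ₀ * (n - v * u))) * Real.exp (μ * (n + ℓ))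
        ≤ Q * Real.exp ((μ * v + lam / 2) * u))
    (hX : X.Nonempty) (hXd : (diam G X : ℝ) ≤ ℓ) {A : Op d} (hA : SupportedOn A X) {t : ℝ}
    (ht : 0 ≤ t) :
    ‖⁅heis H' A t, B⁆‖ ≤ ‖⁅heis H A t, B⁆‖ + ‖A‖ * (4 * Q / lam * M *
      Real.exp (-(μ * setDist G X Y) + (μ * v + lam) * t)) := by
  have key : ∀ u, ∃ W : Op d, IsSelfAdjoint W ∧ (0 ≤ u → ∀ s, 0 ≤ s →
      2 * ‖A‖ * ‖⁅heis H' W s, B⁆‖ + ‖⁅heis H' ⁅H' - H - W, heis H A u⁆ s, B⁆‖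
        ≤ ‖A‖ * (2 * (Q * Real.exp ((μ * v + lam / 2) * u)) * M *
          Real.exp (-(μ * setDist G X Y) + (μ * v + lam) * s))) := by
    intro u
    rcases le_total 0 u with hu | hu
    · obtain ⟨W, h1, h2⟩ := exists_near_part hd hL hγ hp hJ hM0 hμ hℓ hH hH'e hH' hP hS hM hX hXd
        hY hA hu (by positivity) (hnear u hu) (hfar u hu)
      exact ⟨W, h1, fun _ => h2⟩
    · rcases hu.eq_or_lt with rfl | hu
      · obtain ⟨W, h1, h2⟩ := exists_near_part hd hL hγ hp hJ hM0 hμ hℓ hH hH'e hH' hP hS hM hX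
          hXd hY hA le_rfl (by positivity) (hnear 0 le_rfl) (hfar 0 le_rfl)
        exact ⟨W, h1, fun _ => h2⟩
      · exact ⟨0, IsSelfAdjoint.zero _, fun h => absurd h (not_le.2 hu)⟩
  choose W hW1 hW2 using key
  set c : ℝ := ‖A‖ * (2 * Q * M * Real.exp (-(μ * setDist G X Y) + (μ * v + lam) * t)) with hc
  have hc0 : 0 ≤ c := by positivity
  -- The source at elapsed time `t - s` grows at rate `μ v + lam / 2`, short of the target rate by
  -- `lam / 2`. Its integral therefore costs only `2 / lam`, uniformly in `t`.
  have hb : ∀ s : ℝ, HasDerivAt (fun s => c * (2 / lam) * Real.exp (-(lam / 2) * (t - s)))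
      (c * Real.exp (-(lam / 2) * (t - s))) s := by
    intro s
    have h1 : HasDerivAt (fun s : ℝ => -(lam / 2) * (t - s)) (lam / 2) s := by
      have := ((hasDerivAt_id' s).const_sub t).const_mul (-(lam / 2))
      exact this.congr_deriv (by ring)
    exact (h1.exp.const_mul (c * (2 / lam))).congr_deriv (by field_simp)
  have h1 := norm_lie_heis_le (A := A) (B := B) hH hH' (W := fun s => W (t - s))
    (fun s => hW1 _) ht hb ?_
  · refine h1.trans ?_
    gcongr
    have h2 : 0 ≤ c * (2 / lam) * Real.exp (-(lam / 2) * (t - 0)) := by positivity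
    have h3 : c * (2 / lam) * Real.exp (-(lam / 2) * (t - t)) = ‖A‖ * (4 * Q / lam * M *
      Real.exp (-(μ * setDist G X Y) + (μ * v + lam) * t)) := by
      rw [sub_self, mul_zero, Real.exp_zero, hc]; ring
    linarith
  · intro s hs
    refine (hW2 (t - s) (by linarith [hs.2]) s hs.1).trans (le_of_eq ?_)
    rw [hc]
    have : Real.exp ((μ * v + lam / 2) * (t - s)) *
        Real.exp (-(μ * setDist G X Y) + (μ * v + lam) * s)
        = Real.exp (-(μ * setDist G X Y) + (μ * v + lam) * t) *
          Real.exp (-(lam / 2) * (t - s)) := by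
      rw [← Real.exp_add, ← Real.exp_add]; congr 1; ring
    linear_combination 2 * ‖A‖ * Q * M * this

/-- A local bound that improves itself by a contraction holds with the fixed point. -/
lemma LocalBound.of_contraction (hH' : IsSelfAdjoint H') (hμ : 0 ≤ μ) (hν : 0 ≤ ν) {a : ℝ}
    (ha0 : 0 ≤ a) (himp : ∀ M, 0 ≤ M → LocalBound G H' B Y ℓ M μ ν →
      LocalBound G H' B Y ℓ (a + M / 2) μ ν) : LocalBound G H' B Y ℓ (2 * a) μ ν := by
  obtain ⟨M₀, hM₀, hbase⟩ : ∃ M₀, 0 ≤ M₀ ∧ LocalBound G H' B Y ℓ M₀ μ ν := by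
    -- A crude bound for all distances to `Y`, available because there are finitely many sets. The
    -- resulting `M₀` depends on the lattice, but the iteration below halves it away.
    set x : ℝ := ∑ X : Finset V, (setDist G X Y : ℝ) with hx
    refine ⟨2 * ‖B‖ * Real.exp (μ * x), by positivity, fun X _ _ A _ t ht => ?_⟩
    have h1 : (setDist G X Y : ℝ) ≤ x :=
      Finset.single_le_sum (f := fun X : Finset V => (setDist G X Y : ℝ))
        (fun _ _ => Nat.cast_nonneg _) (Finset.mem_univ X)
    have h2 := norm_lie_le (heis H' A t) B
    rw [norm_heis hH'] at h2
    have h3 : 1 ≤ Real.exp (μ * x + (-(μ * setDist G X Y) + ν * t)) := by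
      rw [Real.one_le_exp_iff]
      have := mul_le_mul_of_nonneg_left h1 hμ
      have : 0 ≤ ν * t := by positivity
      linarith
    refine h2.trans ?_
    calc _ ≤ 2 * ‖A‖ * ‖B‖ *
          Real.exp (μ * x + (-(μ * setDist G X Y) + ν * t)) :=
          le_mul_of_one_le_right (by positivity) h3
      _ = _ := by rw [Real.exp_add]; ring
  have hiter : ∀ n : ℕ, LocalBound G H' B Y ℓ (2 * a + M₀ * (1 / 2) ^ n) μ ν := by
    intro n
    induction n with
    | zero =>
      intro X hX hXd A hA t ht
      refine (hbase X hX hXd A hA t ht).trans ?_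
      gcongr
      simpa using ha0
    | succ n ih =>
      have h1 := himp _ (by positivity) ih
      rwa [show a + (2 * a + M₀ * (1 / 2) ^ n) / 2 = 2 * a + M₀ * (1 / 2) ^ (n + 1) by
        rw [pow_succ]; ring] at h1
  intro X hX hXd A hA t ht
  have hlim : Filter.Tendsto (fun n : ℕ => ‖A‖ * ((2 * a + M₀ * (1 / 2) ^ n) *
      Real.exp (-(μ * setDist G X Y) + ν * t))) Filter.atTop
      (nhds (‖A‖ * ((2 * a + M₀ * 0) *
      Real.exp (-(μ * setDist G X Y) + ν * t)))) :=
    (((tendsto_pow_atTop_nhds_zero_of_lt_one (by norm_num) (by norm_num)).const_mul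
      M₀).const_add _ |>.mul_const _).const_mul _
  rw [mul_zero, add_zero] at hlim
  exact ge_of_tendsto' hlim fun n => hiter n X hX hXd A hA t ht

/-- Lieb–Robinson bound for the perturbed evolution at nonnegative times. -/
lemma SiteBound.step_nonneg (hd : ∀ i, 0 < d i) {D : ℕ} {γ : ℝ} (hL : IsLattice G D γ)
    (hγ : 1 ≤ γ) (hp : IsPerturbation G h 𝒵 ℓ J) (hJ : 0 ≤ J) (hℓ : 1 ≤ ℓ)
    {H : Op d} (hH : IsSelfAdjoint H) {μ₀ v θ : ℝ} (hμ₀ : 0 ≤ μ₀) (hθ : 0 ≤ θ) (hθ1 : θ ≤ 1 / 2)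
    (hv : 0 ≤ v) (hS : SiteBound G H 9 μ₀ v)
    {lam Q r₀ Ξ : ℝ} (hlam : 0 < lam) (hr₀ : 0 ≤ r₀) (hQ : 0 ≤ Q) (hΞ1 : 1 ≤ Ξ)
    (hΞ : ∀ X : Finset V, (diam G X : ℝ) ≤ ℓ → (9 * (X.card : ℝ)) ^ θ ≤ Ξ)
    (hnear : ∀ u, 0 ≤ u → 2 * J * nbhdVol D γ ℓ (v * u + r₀) *
      Real.exp (θ * μ₀ * (v * u + r₀ + ℓ)) ≤ Q * Real.exp ((θ * μ₀ * v + lam / 2) * u))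
    (hfar : ∀ u, 0 ≤ u → ∀ m N : ℕ, v * u + r₀ < m + 1 → ∑ n ∈ Finset.Ioc m N, 4 * J * 9 *
      nbhdVol D γ ℓ (n + ℓ) ^ 3 * Real.exp (-(μ₀ * (n - v * u))) *
        Real.exp (θ * μ₀ * (n + ℓ)) ≤ Q * Real.exp ((θ * μ₀ * v + lam / 2) * u))
    (hQΞ : 16 * Q * Ξ ≤ lam) {k : V} (hY : Y.Nonempty) {A : Op d} (hA : SupportedOn A {k})
    (hB : SupportedOn B Y) {t : ℝ} (ht : 0 ≤ t) :
    ‖⁅heis (H + ∑ Z ∈ 𝒵, h Z) A t, B⁆‖ ≤ ‖A‖ * ‖B‖ *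
      (9 * Real.exp (-(θ * μ₀ * setDist G {k} Y) + (θ * μ₀ * v + lam) * t)) := by
  set H' := H + ∑ Z ∈ 𝒵, h Z with hH'e
  have hH' : IsSelfAdjoint H' := hH.add (isSelfAdjoint_sum _ fun Z hZ => hp.isSelfAdjoint Z hZ)
  set μ := θ * μ₀ with hμdef
  have hμ : 0 ≤ μ := mul_nonneg hθ hμ₀
  have hε : 4 * Q / lam ≤ 1 / (4 * Ξ) := by
    rw [div_le_div_iff₀ hlam (by positivity)]; linarith
  have hε' : 4 * Q / lam ≤ 1 / 2 := by
    refine hε.trans ?_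
    rw [div_le_div_iff₀ (by positivity) (by norm_num)]; linarith
  have hexp : ∀ (X : Finset V) (t : ℝ), 0 ≤ t → Real.exp (-(μ * setDist G X Y) + μ * v * |t|)
      ≤ Real.exp (-(μ * setDist G X Y) + (μ * v + lam) * t) := by
    intro X t ht
    rw [abs_of_nonneg ht]
    have := mul_nonneg hlam.le ht
    gcongr
    linarith
  set a : ℝ := 2 * ‖B‖ * Ξ with ha
  have ha0 : 0 ≤ a := by positivity
  have himp : ∀ M, 0 ≤ M → LocalBound G H' B Y ℓ M μ (μ * v + lam) →
      LocalBound G H' B Y ℓ (a + M / 2) μ (μ * v + lam) := by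
    intro M hM0 hM X hX hXd A hA t ht
    have h1 := hM.improve hd hL hγ hp hJ hM0 hμ hℓ hH hH'e hH' (by norm_num) hv hS hlam hr₀ hQ hY
      hnear hfar hX hXd hA ht
    have h2 := hS.norm_lie_heis_le_rpow hd hH (by norm_num) hμ₀ hθ (by linarith) hY hA hB t
    refine h1.trans ?_
    have h3 : ‖⁅heis H A t, B⁆‖ ≤ ‖A‖ *
        (a * Real.exp (-(μ * setDist G X Y) + (μ * v + lam) * t)) := by
      refine h2.trans ?_
      calc _ ≤ 2 * ‖A‖ * ‖B‖ *
            (Ξ * Real.exp (-(μ * setDist G X Y) + (μ * v + lam) * t)) := by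
            have := hexp X t ht
            have := hΞ X hXd
            gcongr
        _ = _ := by rw [ha]; ring
    have h4 : ‖A‖ * (4 * Q / lam * M * Real.exp (-(μ * setDist G X Y) + (μ * v + lam) * t))
        ≤ ‖A‖ * (1 / 2 * M * Real.exp (-(μ * setDist G X Y) + (μ * v + lam) * t)) := by
      gcongr
    refine (add_le_add h3 h4).trans (le_of_eq ?_)
    ring
  have hfin := LocalBound.of_contraction hH' hμ (by positivity) ha0 himp
  -- One further improvement, now at a single site, restores the prefactor: the unperturbed part
  -- gives `2 * 9 ^ θ ≤ 6` and the correction at most 1, within the allowed 9.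
  have h1 := hfin.improve hd hL hγ hp hJ (by positivity) hμ hℓ hH hH'e hH' (by norm_num) hv hS
    hlam hr₀ hQ hY hnear hfar (Finset.singleton_nonempty k) (by simpa using hℓ) hA ht
  have h2 := hS.norm_lie_heis_le_rpow hd hH (by norm_num) hμ₀ hθ (by linarith) hY hA hB t
  refine h1.trans ?_
  have h3 : (9 * (({k} : Finset V).card : ℝ)) ^ θ ≤ 3 := by
    rw [Finset.card_singleton, Nat.cast_one, mul_one]
    calc (9 : ℝ) ^ θ ≤ 9 ^ (1 / 2 : ℝ) := Real.rpow_le_rpow_of_exponent_le (by norm_num) hθ1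
      _ = 3 := by
        rw [← Real.sqrt_eq_rpow, show (9 : ℝ) = 3 ^ 2 by norm_num]
        exact Real.sqrt_sq (by norm_num)
  have h4 : 4 * Q / lam * (2 * a) ≤ ‖B‖ := by
    calc 4 * Q / lam * (2 * a) ≤ 1 / (4 * Ξ) * (2 * a) := by gcongr
      _ = ‖B‖ := by rw [ha]; field_simp; ring
  have h5 := hexp {k} t ht
  set E := Real.exp (-(μ * setDist G {k} Y) + (μ * v + lam) * t)
  have hE : 0 < E := Real.exp_pos _
  have h6 : 2 * ‖A‖ * ‖B‖ * ((9 * (({k} : Finset V).card : ℝ)) ^ θ *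
      Real.exp (-(μ * setDist G {k} Y) + μ * v * |t|)) ≤ 2 * ‖A‖ * ‖B‖ * (3 * E) :=
    mul_le_mul_of_nonneg_left (mul_le_mul h3 h5 (Real.exp_pos _).le (by norm_num))
      (by positivity)
  have h7 : ‖A‖ * (4 * Q / lam * (2 * a) * E) ≤ ‖A‖ * (‖B‖ * E) :=
    mul_le_mul_of_nonneg_left (mul_le_mul_of_nonneg_right h4 hE.le) (norm_nonneg _)
  have h8 : 0 ≤ ‖A‖ * ‖B‖ * E := by positivity
  linarith

/-- One step of the induction over the interaction range. -/
theorem SiteBound.step (hd : ∀ i, 0 < d i) {D : ℕ} {γ : ℝ} (hL : IsLattice G D γ)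
    (hγ : 1 ≤ γ) (hp : IsPerturbation G h 𝒵 ℓ J) (hJ : 0 ≤ J) (hℓ : 1 ≤ ℓ)
    {H : Op d} (hH : IsSelfAdjoint H) {μ₀ v v' θ : ℝ} (hμ₀ : 0 ≤ μ₀) (hθ : 0 ≤ θ)
    (hθ1 : θ ≤ 1 / 2) (hv : 0 ≤ v) (hS : SiteBound G H 9 μ₀ v)
    {lam Q r₀ Ξ : ℝ} (hlam : 0 < lam) (hr₀ : 0 ≤ r₀) (hQ : 0 ≤ Q) (hΞ1 : 1 ≤ Ξ)
    (hΞ : ∀ X : Finset V, (diam G X : ℝ) ≤ ℓ → (9 * (X.card : ℝ)) ^ θ ≤ Ξ)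
    (hnear : ∀ u, 0 ≤ u → 2 * J * nbhdVol D γ ℓ (v * u + r₀) *
      Real.exp (θ * μ₀ * (v * u + r₀ + ℓ)) ≤ Q * Real.exp ((θ * μ₀ * v + lam / 2) * u))
    (hfar : ∀ u, 0 ≤ u → ∀ m N : ℕ, v * u + r₀ < m + 1 → ∑ n ∈ Finset.Ioc m N, 4 * J * 9 *
      nbhdVol D γ ℓ (n + ℓ) ^ 3 * Real.exp (-(μ₀ * (n - v * u))) *
        Real.exp (θ * μ₀ * (n + ℓ)) ≤ Q * Real.exp ((θ * μ₀ * v + lam / 2) * u))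
    (hQΞ : 16 * Q * Ξ ≤ lam) (hv' : θ * μ₀ * v + lam ≤ θ * μ₀ * v') :
    SiteBound G (H + ∑ Z ∈ 𝒵, h Z) 9 (θ * μ₀) v' := by
  have hmono : ∀ (k : V) (Y : Finset V) (t : ℝ), 0 ≤ t →
      Real.exp (-(θ * μ₀ * setDist G {k} Y) + (θ * μ₀ * v + lam) * t)
        ≤ Real.exp (-(θ * μ₀ * setDist G {k} Y) + θ * μ₀ * v' * t) := by
    intro k Y t ht
    gcongr
  intro k Y hY A B hA hB t
  rcases le_total 0 t with ht | ht
  · rw [abs_of_nonneg ht]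
    refine (hS.step_nonneg hd hL hγ hp hJ hℓ hH hμ₀ hθ hθ1 hv hlam hr₀ hQ hΞ1 hΞ hnear hfar hQΞ hY
      hA hB ht).trans ?_
    gcongr _ * (_ * ?_)
    exact hmono k Y t ht
  -- Negative times are positive times for `-H` and `-h`, which satisfy the same hypotheses.
  · rw [abs_of_nonpos ht, ← neg_neg t, ← heis_neg_left, neg_neg, neg_add,
      ← Finset.sum_neg_distrib]
    have ht' : 0 ≤ -t := by linarith
    refine (hS.neg.step_nonneg hd hL hγ (hp.neg hd) hJ hℓ hH.neg hμ₀ hθ hθ1 hv hlam hr₀ hQ hΞ1 hΞ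
      hnear hfar hQΞ hY hA hB ht').trans ?_
    gcongr _ * (_ * ?_)
    exact hmono k Y _ ht'

end Perturbation

/-! ### Numerical estimates -/

section Numerics

lemma sum_exp_Ioc_le {c : ℝ} (hc : 0 < c) {x : ℝ} {m : ℕ} (hx : x ≤ m + 1) (N : ℕ) :
    ∑ n ∈ Finset.Ioc m N, Real.exp (-(c * (n - x))) ≤ 1 + 1 / c := by
  have hq0 : 0 ≤ Real.exp (-c) := (Real.exp_pos _).le
  have hq1 : Real.exp (-c) < 1 := by simpa using hc
  have h1 : ∑ n ∈ Finset.Ioc m N, Real.exp (-(c * (n - x)))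
      ≤ ∑ n ∈ Finset.Ico (m + 1) (N + 1), Real.exp (-c) ^ (n - (m + 1)) := by
    have : Finset.Ioc m N = Finset.Ico (m + 1) (N + 1) := by
      ext; simp only [Finset.mem_Ioc, Finset.mem_Ico]; omega
    rw [this]
    refine Finset.sum_le_sum fun n hn => ?_
    have hmn : m + 1 ≤ n := (Finset.mem_Ico.1 hn).1
    rw [← Real.exp_nat_mul]
    push_cast [Nat.cast_sub hmn]
    rw [Real.exp_le_exp]
    nlinarith
  have h2 : ∑ n ∈ Finset.Ico (m + 1) (N + 1), Real.exp (-c) ^ (n - (m + 1))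
      ≤ (1 - Real.exp (-c))⁻¹ := by
    rw [Finset.sum_Ico_eq_sum_range]
    simp only [add_tsub_cancel_left]
    have := (summable_geometric_of_lt_one hq0 hq1).sum_le_tsum (Finset.range (N + 1 - (m + 1)))
      (fun i _ => pow_nonneg hq0 i)
    rwa [tsum_geometric_of_lt_one hq0 hq1] at this
  refine h1.trans (h2.trans ?_)
  have h3 : c + 1 ≤ Real.exp c := Real.add_one_le_exp c
  have h4 : Real.exp (-c) ≤ 1 / (c + 1) := by
    rw [Real.exp_neg, ← one_div]
    exact one_div_le_one_div_of_le (by linarith) h3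
  have h5 : c / (c + 1) ≤ 1 - Real.exp (-c) := by
    have : c / (c + 1) = 1 - 1 / (c + 1) := by field_simp; ring
    linarith
  calc (1 - Real.exp (-c))⁻¹ ≤ (c / (c + 1))⁻¹ := inv_anti₀ (by positivity) h5
    _ = 1 + 1 / c := by field_simp

variable {D : ℕ} {γ J ℓ ℓ' v lam r₀ L Λ Q : ℝ}

/-- Polynomial volume growth is absorbed by `1 + y ≤ exp y`. The far estimate uses the cube of the
volume, so the rates `lam / 6` and `1 / (12 ℓ)` become `lam / 2` and `1 / (4 ℓ)` there. -/
lemma nbhdVol_le (hD : 1 ≤ D) (hγ : 1 ≤ γ) (hℓ : 0 < ℓ) (hlam : 0 < lam) (hv : 0 ≤ v)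
    (hL1 : 6 * D * v / lam + r₀ + 12 * D * ℓ + 2 * ℓ' ≤ L) {u x c : ℝ}
    (hu : 0 ≤ u) (hx : 0 ≤ x) (hc : 0 ≤ c) (hcL : c ≤ r₀ + 2 * ℓ') :
    γ * (2 * (v * u + x + c)) ^ D
      ≤ γ * (2 * L) ^ D * Real.exp (lam / 6 * u + x / (12 * ℓ)) := by
  have hD0 : (0 : ℝ) < D := by exact_mod_cast hD
  have hvl : 0 ≤ 6 * D * v / lam := by positivity
  set y : ℝ := lam / (6 * D) * u + x / (12 * D * ℓ) with hy
  have hy0 : 0 ≤ y := by positivity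
  have h1 : v * u + x + c ≤ L * (y + 1) := by
    have e1 : v * u = 6 * D * v / lam * (lam / (6 * D) * u) := by field_simp
    have e2 : x = 12 * D * ℓ * (x / (12 * D * ℓ)) := by field_simp
    have g1 : 6 * D * v / lam * (lam / (6 * D) * u) ≤ L * (lam / (6 * D) * u) :=
      mul_le_mul_of_nonneg_right (by nlinarith) (by positivity)
    have g2 : 12 * D * ℓ * (x / (12 * D * ℓ)) ≤ L * (x / (12 * D * ℓ)) :=
      mul_le_mul_of_nonneg_right (by nlinarith) (by positivity)
    have g3 : c ≤ L := by nlinarith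
    rw [hy]
    linarith
  have hL0 : 0 ≤ L := by nlinarith
  have h2 : v * u + x + c ≤ L * Real.exp y :=
    h1.trans (mul_le_mul_of_nonneg_left (Real.add_one_le_exp y) hL0)
  have e3 : Real.exp (lam / 6 * u + x / (12 * ℓ)) = Real.exp y ^ D := by
    rw [← Real.exp_nat_mul]; congr 1; rw [hy]; field_simp
  calc _ ≤ γ * (2 * (L * Real.exp y)) ^ D := by gcongr
    _ = _ := by rw [e3, ← mul_assoc 2 L, mul_pow (2 * L), mul_assoc]

lemma near_estimate (hD : 1 ≤ D) (hγ : 1 ≤ γ) (hJ : 0 ≤ J) (hℓ : 0 < ℓ) (hℓ' : 0 < ℓ')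
    (hlam : 0 < lam) (hv : 0 ≤ v) (hr₀ : 0 ≤ r₀)
    (hL1 : 6 * D * v / lam + r₀ + 12 * D * ℓ + 2 * ℓ' ≤ L)
    (hΛ : Real.exp (2 * r₀ / ℓ') ≤ Λ)
    (hQ : 36 * Real.exp 2 * J * γ ^ 3 * 8 ^ D * L ^ D * Λ ≤ Q) {u : ℝ} (hu : 0 ≤ u) :
    2 * J * nbhdVol D γ ℓ' (v * u + r₀) * Real.exp (2 / ℓ' * (v * u + r₀ + ℓ'))
      ≤ Q * Real.exp ((2 / ℓ' * v + lam / 2) * u) := by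
  have hvl : 0 ≤ 6 * D * v / lam := by positivity
  have hL0 : 0 ≤ L := by
    have : (0 : ℝ) ≤ 12 * D * ℓ := by positivity
    linarith
  have h1 := nbhdVol_le (c := r₀ + ℓ') hD hγ hℓ hlam hv hL1 hu le_rfl (by positivity)
    (by linarith)
  have e1 : v * u + 0 + (r₀ + ℓ') = v * u + r₀ + ℓ' := by ring
  rw [e1, zero_div, add_zero] at h1
  have e2 : Real.exp (2 / ℓ' * (v * u + r₀ + ℓ'))
      = Real.exp 2 * Real.exp (2 * r₀ / ℓ') * Real.exp (2 / ℓ' * v * u) := by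
    rw [← Real.exp_add, ← Real.exp_add]; congr 1; field_simp; ring
  have hΛ0 : 0 ≤ Λ := (Real.exp_pos _).le.trans hΛ
  have h3 : Real.exp (lam / 6 * u) ≤ Real.exp (lam / 2 * u) := by gcongr; norm_num
  have h4 : γ ≤ γ ^ 3 := le_self_pow₀ hγ (by norm_num)
  have h5 : (2 : ℝ) ^ D ≤ 8 ^ D := by gcongr; norm_num
  unfold nbhdVol
  rw [e2]
  calc _ ≤ 2 * J * (γ * (2 * L) ^ D * Real.exp (lam / 2 * u)) *
        (Real.exp 2 * Λ * Real.exp (2 / ℓ' * v * u)) := by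
        have h6 : γ * (2 * (v * u + r₀ + ℓ')) ^ D ≤ γ * (2 * L) ^ D * Real.exp (lam / 2 * u) :=
          h1.trans (mul_le_mul_of_nonneg_left h3 (by positivity))
        gcongr
    _ = 2 * Real.exp 2 * J * γ * 2 ^ D * L ^ D * Λ * Real.exp ((2 / ℓ' * v + lam / 2) * u) := by
        rw [add_mul, Real.exp_add, mul_pow]; ring
    _ ≤ 36 * Real.exp 2 * J * γ ^ 3 * 8 ^ D * L ^ D * Λ *
        Real.exp ((2 / ℓ' * v + lam / 2) * u) := by
        gcongr; norm_num
    _ ≤ _ := by gcongr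

/-- The decay `2 / ℓ` in the distance `x` beyond the light cone is spent in four parts: `1 / ℓ`
beats the new rate `2 / ℓ'`, `1 / (2 ℓ)` yields the small factor `exp (-r₀ / (2 ℓ))`, and `1 / (4
ℓ)` each pays for the cubed volume and for the sum over `n`. The small factor cancels `L ^ (2 D +
1)`, that is, two of the three volumes and the sum. -/
lemma far_estimate (hD : 1 ≤ D) (hγ : 1 ≤ γ) (hJ : 0 ≤ J) (hℓ : 0 < ℓ) (hℓ' : 0 < ℓ')
    (hℓℓ' : 2 * ℓ ≤ ℓ') (hlam : 0 < lam) (hv : 0 ≤ v) (hr₀ : 0 ≤ r₀)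
    (hL1 : 6 * D * v / lam + r₀ + 12 * D * ℓ + 2 * ℓ' ≤ L) (hL2 : 1 + 4 * ℓ ≤ L)
    (hL3 : L ^ (2 * D + 1) * Real.exp (-(r₀ / (2 * ℓ))) ≤ 1) (hΛ : 1 ≤ Λ)
    (hQ : 36 * Real.exp 2 * J * γ ^ 3 * 8 ^ D * L ^ D * Λ ≤ Q) {u : ℝ} (hu : 0 ≤ u) {m N : ℕ}
    (hm : v * u + r₀ < m + 1) :
    ∑ n ∈ Finset.Ioc m N, 4 * J * 9 * nbhdVol D γ ℓ' (n + ℓ') ^ 3 *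
      Real.exp (-(2 / ℓ * (n - v * u))) * Real.exp (2 / ℓ' * (n + ℓ'))
        ≤ Q * Real.exp ((2 / ℓ' * v + lam / 2) * u) := by
  have hL0 : 0 ≤ L := by linarith
  set c₀ : ℝ := 36 * Real.exp 2 * J * γ ^ 3 * 8 ^ D * L ^ (3 * D) * Real.exp (-(r₀ / (2 * ℓ))) *
    Real.exp ((2 / ℓ' * v + lam / 2) * u) with hc₀
  have hterm : ∀ n ∈ Finset.Ioc m N, 4 * J * 9 * nbhdVol D γ ℓ' (n + ℓ') ^ 3 *
      Real.exp (-(2 / ℓ * (n - v * u))) * Real.exp (2 / ℓ' * (n + ℓ'))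
        ≤ c₀ * Real.exp (-(1 / (4 * ℓ) * (n - v * u))) := by
    intro n hn
    have hmn : (m : ℝ) + 1 ≤ n := by exact_mod_cast (Finset.mem_Ioc.1 hn).1
    set x : ℝ := n - v * u with hx
    have hxr : r₀ ≤ x := by linarith
    have hx0 : 0 ≤ x := hr₀.trans hxr
    have hnx : (n : ℝ) = v * u + x := by rw [hx]; ring
    have h1 := nbhdVol_le (c := 2 * ℓ') hD hγ hℓ hlam hv hL1 hu hx0 (by positivity)
      (by linarith)
    have h2 : nbhdVol D γ ℓ' (n + ℓ') ≤ γ * (2 * L) ^ D *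
        Real.exp (lam / 6 * u + x / (12 * ℓ)) := by
      unfold nbhdVol
      rw [hnx, show v * u + x + ℓ' + ℓ' = v * u + x + 2 * ℓ' by ring]
      exact h1
    have h20 : 0 ≤ nbhdVol D γ ℓ' (n + ℓ') := by
      unfold nbhdVol; positivity
    have hinv : 2 / ℓ' ≤ 1 / ℓ := by
      rw [div_le_div_iff₀ hℓ' hℓ]; linarith
    have hx2 : 2 / ℓ' * x ≤ 1 / ℓ * x := mul_le_mul_of_nonneg_right hinv hx0
    have hrx : r₀ / (2 * ℓ) ≤ x / (2 * ℓ) := by gcongr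
    calc _ ≤ 4 * J * 9 * (γ * (2 * L) ^ D * Real.exp (lam / 6 * u + x / (12 * ℓ))) ^ 3 *
          Real.exp (-(2 / ℓ * x)) * Real.exp (2 / ℓ' * (n + ℓ')) := by gcongr
      _ = 36 * J * γ ^ 3 * 8 ^ D * L ^ (3 * D) * Real.exp (3 * (lam / 6 * u + x / (12 * ℓ))
          + -(2 / ℓ * x) + 2 / ℓ' * (n + ℓ')) := by
          have e3 : Real.exp (3 * (lam / 6 * u + x / (12 * ℓ)))
              = Real.exp (lam / 6 * u + x / (12 * ℓ)) ^ 3 := by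
            rw [← Real.exp_nat_mul]; norm_num
          have e8 : ((2 : ℝ) ^ D) ^ 3 = 8 ^ D := by
            rw [← pow_mul, mul_comm, pow_mul]; norm_num
          rw [Real.exp_add _ (2 / ℓ' * (n + ℓ')), Real.exp_add (3 * _), e3, ← e8, mul_comm 3 D, pow_mul]
          ring
      _ ≤ 36 * J * γ ^ 3 * 8 ^ D * L ^ (3 * D) * Real.exp (2 + -(r₀ / (2 * ℓ)) +
          (2 / ℓ' * v + lam / 2) * u + -(1 / (4 * ℓ) * x)) := by
          refine mul_le_mul_of_nonneg_left (Real.exp_le_exp.2 ?_) (by positivity)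
          have e1 : 2 / ℓ' * ((n : ℝ) + ℓ') = 2 / ℓ' * v * u + 2 / ℓ' * x + 2 := by
            rw [hnx]; field_simp
          have e2 : 3 * (lam / 6 * u + x / (12 * ℓ)) = lam / 2 * u + 1 / (4 * ℓ) * x := by
            field_simp; ring
          have e3 : 2 / ℓ * x = 1 / ℓ * x + x / (2 * ℓ) + 2 * (1 / (4 * ℓ) * x) := by
            field_simp; ring
          rw [e1, e2, e3]
          linarith
      _ = _ := by
          rw [Real.exp_add, Real.exp_add, Real.exp_add, hc₀]; ring
  refine (Finset.sum_le_sum hterm).trans ?_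
  rw [← Finset.mul_sum]
  have hsum : ∑ n ∈ Finset.Ioc m N, Real.exp (-(1 / (4 * ℓ) * (n - v * u))) ≤ L := by
    refine (sum_exp_Ioc_le (by positivity) (by linarith) N).trans ?_
    rw [one_div_one_div]; exact hL2
  have hc₀0 : 0 ≤ c₀ := by positivity
  calc _ ≤ c₀ * L := by gcongr
    _ = 36 * Real.exp 2 * J * γ ^ 3 * 8 ^ D * L ^ D *
        (L ^ (2 * D + 1) * Real.exp (-(r₀ / (2 * ℓ)))) *
          Real.exp ((2 / ℓ' * v + lam / 2) * u) := by
        rw [hc₀, show 3 * D = D + 2 * D by ring, pow_add, pow_succ]; ring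
    _ ≤ 36 * Real.exp 2 * J * γ ^ 3 * 8 ^ D * L ^ D * Λ *
          Real.exp ((2 / ℓ' * v + lam / 2) * u) := by
        gcongr; exact hL3.trans hΛ
    _ ≤ _ := by gcongr

/-- A length scale `C ℓ^{1+κ}` dominates the other lengths of one induction step. -/
lemma exists_length_scale (D : ℕ) {κ η K : ℝ} (hκ : 0 < κ) (hη : 1 ≤ η) :
    ∃ C : ℝ, 1 ≤ C ∧ ∀ ℓ : ℝ, 1 / η ≤ ℓ →
      1 + 4 * ℓ ≤ C * ℓ ^ (1 + κ) ∧
      6 * D * (K * ℓ ^ (1 + κ)) + 2 * (2 * D + 1) * ℓ * Real.log (C * ℓ ^ (1 + κ)) + 12 * D * ℓ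
        + 2 * (η * ℓ) ≤ C * ℓ ^ (1 + κ) := by
  set b : ℝ := 2 * (2 * D + 1) * η ^ κ with hb
  set a : ℝ := 6 * D * K + 2 * (2 * D + 1) * ((1 + κ) / κ) + (12 * D + 2 * η) * η ^ κ with ha
  have hlim : ∀ᶠ C : ℝ in Filter.atTop, a + b * Real.log C ≤ C := by
    have h1 : (fun C : ℝ => a + b * Real.log C) =o[Filter.atTop] (fun C : ℝ => C) :=
      (Asymptotics.isLittleO_const_left.2 (Or.inr (tendsto_norm_atTop_atTop))).add
        (Real.isLittleO_log_id_atTop.const_mul_left b)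
    filter_upwards [h1.bound one_pos, Filter.eventually_ge_atTop (0 : ℝ)] with C hC hC0
    rw [one_mul, Real.norm_of_nonneg hC0] at hC
    exact (le_abs_self _).trans hC
  obtain ⟨C, hC, hC1, hC2⟩ := (hlim.and ((Filter.eventually_ge_atTop (1 : ℝ)).and
    (Filter.eventually_ge_atTop (η ^ (1 + κ) + 4 * η ^ κ)))).exists
  refine ⟨C, hC1, fun ℓ hℓ => ?_⟩
  have hη0 : 0 < η := by linarith
  have hℓ0 : 0 < ℓ := lt_of_lt_of_le (by positivity) hℓ
  have hηℓ : 1 ≤ η * ℓ := by rwa [div_le_iff₀' hη0] at hℓ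
  set w := ℓ ^ (1 + κ) with hw
  have hw0 : 0 < w := Real.rpow_pos_of_pos hℓ0 _
  have hwe : w = ℓ * ℓ ^ κ := by rw [hw, Real.rpow_add hℓ0, Real.rpow_one]
  -- The length `ℓ` may be below 1 but not below `1 / η`, so comparing powers of `ℓ` costs powers of
  -- `η`.
  have h1 : 1 ≤ η ^ (1 + κ) * w := by
    rw [hw, ← Real.mul_rpow hη0.le hℓ0.le]; exact Real.one_le_rpow hηℓ (by linarith)
  have h2 : ℓ ≤ η ^ κ * w := by
    have : 1 ≤ η ^ κ * ℓ ^ κ := by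
      rw [← Real.mul_rpow hη0.le hℓ0.le]; exact Real.one_le_rpow hηℓ hκ.le
    calc ℓ = ℓ * 1 := (mul_one _).symm
      _ ≤ ℓ * (η ^ κ * ℓ ^ κ) := by gcongr
      _ = _ := by rw [hwe]; ring
  -- The logarithm in `r₀` is one reason for the extra power `ℓ ^ κ` in the length scale.
  have h3 : ℓ * Real.log ℓ ≤ w / κ := by
    calc ℓ * Real.log ℓ ≤ ℓ * (ℓ ^ κ / κ) := by
          gcongr; exact Real.log_le_rpow_div hℓ0.le hκ
      _ = _ := by rw [hwe]; ring
  have hlog : Real.log (C * w) = Real.log C + (1 + κ) * Real.log ℓ := by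
    rw [Real.log_mul (by linarith) hw0.ne', hw, Real.log_rpow hℓ0]
  have h4 : ℓ * Real.log C ≤ η ^ κ * w * Real.log C :=
    mul_le_mul_of_nonneg_right h2 (Real.log_nonneg hC1)
  constructor
  · calc 1 + 4 * ℓ ≤ η ^ (1 + κ) * w + 4 * (η ^ κ * w) := by gcongr
      _ = (η ^ (1 + κ) + 4 * η ^ κ) * w := by ring
      _ ≤ C * w := by gcongr
  · have hD0 : (0 : ℝ) ≤ D := Nat.cast_nonneg D
    calc _ = 6 * D * (K * w) + 2 * (2 * D + 1) * (ℓ * Real.log C)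
          + 2 * (2 * D + 1) * ((1 + κ) * (ℓ * Real.log ℓ)) + (12 * D + 2 * η) * ℓ := by
          rw [hlog]; ring
      _ ≤ 6 * D * (K * w) + 2 * (2 * D + 1) * (η ^ κ * w * Real.log C)
          + 2 * (2 * D + 1) * ((1 + κ) * (w / κ)) + (12 * D + 2 * η) * (η ^ κ * w) := by
          gcongr
      _ = (a + b * Real.log C) * w := by rw [ha, hb]; ring
      _ ≤ C * w := by gcongr

end Numerics

/-! ### Induction over the interaction range -/

section Induction

set_option linter.unusedSectionVars false

/-- At `κ = 0` the inequality is strict. For `κ ≤ 1` the left side is at most `D + 1 + κ (D + 5)`,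
which explains the denominator. -/
lemma exists_exponent (D : ℕ) {α : ℝ} (hα : 2 * (D : ℝ) + 1 < α) :
    ∃ κ : ℝ, 0 < κ ∧ κ ≤ 1 ∧ (1 + κ) * (D + 1 + 2 * κ) ≤ α - D := by
  have hD : (0 : ℝ) ≤ D := Nat.cast_nonneg D
  refine ⟨min 1 ((α - 2 * D - 1) / (D + 5)), lt_min one_pos ?_, min_le_left _ _, ?_⟩
  · have : 0 < α - 2 * D - 1 := by linarith
    positivity
  · set κ := min 1 ((α - 2 * D - 1) / (D + 5)) with hκ
    have h1 : κ ≤ 1 := min_le_left _ _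
    have h2 : κ * (D + 5) ≤ α - 2 * D - 1 := by
      rw [← le_div_iff₀ (by positivity)]; exact min_le_right _ _
    have h3 : 0 ≤ κ := by
      refine le_min zero_le_one ?_
      have : 0 < α - 2 * D - 1 := by linarith
      positivity
    nlinarith

variable {V : Type*} [Fintype V] [DecidableEq V] {G : SimpleGraph V} {d : V → ℕ}

set_option maxHeartbeats 1000000 in
/-- Enlarging the interaction range from `ℓ` to `η ℓ` changes the velocity by an amount of order
`ℓ^{-κ}`. -/
lemma SiteBound.scale_step (hd : ∀ i, 0 < d i) {D : ℕ} (hD : 1 ≤ D) {α γ g : ℝ}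
    (hL : IsLattice G D γ) (hγ : 1 ≤ γ) (hg : 0 < g) {κ η K C v₀ : ℝ} (hκ : 0 < κ) (hκ1 : κ ≤ 1)
    (hα : (1 + κ) * (D + 1 + 2 * κ) ≤ α - D) (hη : η = (8 * D + 4) / κ)
    (hC1 : 1 ≤ C)
    (hC : ∀ ℓ : ℝ, 1 / η ≤ ℓ →
      1 + 4 * ℓ ≤ C * ℓ ^ (1 + κ) ∧
      6 * D * (K * ℓ ^ (1 + κ)) + 2 * (2 * D + 1) * ℓ * Real.log (C * ℓ ^ (1 + κ)) + 12 * D * ℓ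
        + 2 * (η * ℓ) ≤ C * ℓ ^ (1 + κ))
    (hv₀ : v₀ = 5184 * Real.exp 2 * γ ^ 4 * 8 ^ D * g * C ^ (D + 2 * κ) *
      (1 / η) ^ ((1 + κ) * (D + 1 + 2 * κ) - α + D))
    {ℓ : ℝ} (hℓ : 1 / η ≤ ℓ) {h : Finset V → Op d} {𝒵 : Finset (Finset V)}
    (hp : IsPerturbation G h 𝒵 (η * ℓ) (g * ℓ ^ (-α + D))) {H : Op d} (hH : IsSelfAdjoint H)
    {v v' : ℝ} (hv : 0 ≤ v) (hvK : v ≤ v₀ * K) (hv' : v + v₀ * (η / 2) * ℓ ^ (-κ) ≤ v')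
    (hS : SiteBound G H 9 (2 / ℓ) v) :
    SiteBound G (H + ∑ Z ∈ 𝒵, h Z) 9 (2 / (η * ℓ)) v' := by
  have hD0 : (1 : ℝ) ≤ D := by exact_mod_cast hD
  have hη12 : 12 ≤ η := by
    rw [hη, le_div_iff₀ hκ]; nlinarith
  have hη0 : 0 < η := by linarith
  have hℓ0 : 0 < ℓ := lt_of_lt_of_le (by positivity) hℓ
  have hηℓ : 1 ≤ η * ℓ := by rwa [div_le_iff₀' hη0] at hℓ
  obtain ⟨hL2, hL1⟩ := hC ℓ hℓ
  set L := C * ℓ ^ (1 + κ) with hLdef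
  have hL1' : 1 ≤ L := by linarith
  have hL0 : 0 < L := by linarith
  -- Chosen so that `exp (-r₀ / (2 ℓ))` equals `L ^ (-(2 D + 1))`. At the new rate the same width
  -- costs only `exp (2 r₀ / (η ℓ)) = L ^ κ`, by the choice of `η`.
  set r₀ := 2 * (2 * D + 1) * ℓ * Real.log L with hr₀
  have hr₀0 : 0 ≤ r₀ := by
    have := Real.log_nonneg hL1'
    positivity
  have hv₀0 : 0 < v₀ := by rw [hv₀]; positivity
  set lam := v₀ * ℓ ^ (-(1 + κ)) with hlam
  have hlam0 : 0 < lam := by positivity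
  have hvlam : 6 * D * v / lam ≤ 6 * D * (K * ℓ ^ (1 + κ)) := by
    rw [div_le_iff₀ hlam0, hlam]
    have e : ℓ ^ (1 + κ) * ℓ ^ (-(1 + κ)) = 1 := by
      rw [← Real.rpow_add hℓ0]; simp
    calc 6 * D * v ≤ 6 * D * (v₀ * K) := by gcongr
      _ = 6 * D * (v₀ * K) * (ℓ ^ (1 + κ) * ℓ ^ (-(1 + κ))) := by rw [e, mul_one]
      _ = _ := by ring
  have hLL : 6 * D * v / lam + r₀ + 12 * D * ℓ + 2 * (η * ℓ) ≤ L := by linarith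
  have hL3 : L ^ (2 * D + 1) * Real.exp (-(r₀ / (2 * ℓ))) ≤ 1 := by
    have : r₀ / (2 * ℓ) = ((2 * D + 1 : ℕ) : ℝ) * Real.log L := by
      rw [hr₀]; push_cast; field_simp
    rw [this, Real.exp_neg, Real.exp_nat_mul, Real.exp_log hL0,
      mul_inv_cancel₀ (by positivity)]
  have hΛ : Real.exp (2 * r₀ / (η * ℓ)) ≤ L ^ κ := by
    refine le_of_eq ?_
    rw [Real.rpow_def_of_pos hL0]
    congr 1
    rw [hr₀, hη]; field_simp; ring
  have hΛ1 : 1 ≤ L ^ κ := Real.one_le_rpow hL1' hκ.le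
  set J := g * ℓ ^ (-α + D) with hJ
  have hJ0 : 0 ≤ J := by positivity
  set Q := 36 * Real.exp 2 * J * γ ^ 3 * 8 ^ D * L ^ D * L ^ κ with hQ
  have hθμ : 1 / η * (2 / ℓ) = 2 / (η * ℓ) := by field_simp
  have hηℓL : η * ℓ ≤ L := by
    have h1 : 0 ≤ 6 * D * v / lam := by positivity
    have h2 : 0 ≤ 12 * D * ℓ := by positivity
    linarith
  have hΞ : ∀ X : Finset V, (diam G X : ℝ) ≤ η * ℓ →
      (9 * (X.card : ℝ)) ^ (1 / η) ≤ 9 * γ * L ^ κ := by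
    intro X hX
    have h1 : 9 * (X.card : ℝ) ≤ 9 * γ * L ^ D := by
      rw [mul_assoc]
      gcongr
      refine (hL.card_le X).trans ?_
      have := hX.trans hηℓL
      gcongr
    have hη1 : 1 / η ≤ 1 := by rw [div_le_one hη0]; linarith
    have hκη : D * (1 / η) ≤ κ := by
      rw [mul_one_div, div_le_iff₀ hη0, hη]; field_simp; linarith
    calc _ ≤ (9 * γ * L ^ D) ^ (1 / η) := by gcongr
      _ = (9 * γ) ^ (1 / η) * L ^ (D * (1 / η)) := by
          rw [Real.mul_rpow (by positivity) (by positivity), ← Real.rpow_natCast,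
            ← Real.rpow_mul hL0.le]
      _ ≤ 9 * γ * L ^ κ := by
          gcongr ?_ * ?_
          · calc (9 * γ) ^ (1 / η) ≤ (9 * γ) ^ (1 : ℝ) :=
                Real.rpow_le_rpow_of_exponent_le (by linarith) hη1
              _ = 9 * γ := Real.rpow_one _
          · exact Real.rpow_le_rpow_of_exponent_le hL1' hκη
  -- The exponents meet here: after `ℓ ^ (-(1 + κ))` is split off, the exponent `e` of `ℓ` is
  -- nonpositive, so its power is largest at `ℓ = 1 / η`, which is the value built into `v₀`.
  have hQΞ : 16 * Q * (9 * γ * L ^ κ) ≤ lam := by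
    set e := (1 + κ) * (D + 1 + 2 * κ) - α + D with he
    have he0 : e ≤ 0 := by linarith
    have h1 : L ^ D * L ^ κ * L ^ κ = C ^ (D + 2 * κ) * ℓ ^ ((1 + κ) * (D + 2 * κ)) := by
      rw [← Real.rpow_natCast, ← Real.rpow_add hL0, ← Real.rpow_add hL0,
        show (D : ℝ) + κ + κ = D + 2 * κ by ring, hLdef,
        Real.mul_rpow (by linarith) (by positivity), ← Real.rpow_mul hℓ0.le]
    have h2 : ℓ ^ ((1 + κ) * (D + 2 * κ)) * ℓ ^ (-α + D) = ℓ ^ e * ℓ ^ (-(1 + κ)) := by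
      rw [← Real.rpow_add hℓ0, ← Real.rpow_add hℓ0]; congr 1; rw [he]; ring
    have h3 : ℓ ^ e ≤ (1 / η) ^ e :=
      Real.rpow_le_rpow_of_nonpos (by positivity) hℓ he0
    calc 16 * Q * (9 * γ * L ^ κ)
        = 5184 * Real.exp 2 * γ ^ 4 * 8 ^ D * J * (L ^ D * L ^ κ * L ^ κ) := by rw [hQ]; ring
      _ = 5184 * Real.exp 2 * γ ^ 4 * 8 ^ D * g * C ^ (D + 2 * κ) *
          (ℓ ^ ((1 + κ) * (D + 2 * κ)) * ℓ ^ (-α + D)) := by rw [h1, hJ]; ring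
      _ = 5184 * Real.exp 2 * γ ^ 4 * 8 ^ D * g * C ^ (D + 2 * κ) * ℓ ^ e * ℓ ^ (-(1 + κ)) := by
          rw [h2]; ring
      _ ≤ 5184 * Real.exp 2 * γ ^ 4 * 8 ^ D * g * C ^ (D + 2 * κ) * (1 / η) ^ e *
          ℓ ^ (-(1 + κ)) := by gcongr
      _ = lam := by rw [hlam, hv₀]
  have hvv : 2 / (η * ℓ) * v + lam ≤ 2 / (η * ℓ) * v' := by
    have h1 : ℓ ^ (-κ) = ℓ * ℓ ^ (-(1 + κ)) := by
      nth_rewrite 2 [← Real.rpow_one ℓ]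
      rw [← Real.rpow_add hℓ0]; congr 1; ring
    calc 2 / (η * ℓ) * v + lam = 2 / (η * ℓ) * (v + v₀ * (η / 2) * ℓ ^ (-κ)) := by
          rw [h1, hlam]; field_simp
      _ ≤ _ := by gcongr
  have hfin := hS.step hd hL hγ hp hJ0 hηℓ hH (v' := v') (θ := 1 / η) (by positivity) (by positivity)
    (by rw [div_le_div_iff₀ hη0 two_pos]; linarith) hv hlam0 hr₀0 (Q := Q) (by positivity)
    (Ξ := 9 * γ * L ^ κ) (by nlinarith) hΞ
    (by
      rw [hθμ]
      exact fun u hu => near_estimate hD hγ hJ0 hℓ0 (by positivity) hlam0 hv hr₀0 hLL hΛ le_rfl hu)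
    (by
      rw [hθμ]
      exact fun u hu m N hm => far_estimate hD hγ hJ0 hℓ0 (by positivity) (by nlinarith) hlam0 hv
        hr₀0 hLL hL2 hL3 hΛ1 le_rfl hu hm)
    hQΞ (by rw [hθμ]; exact hvv)
  rwa [hθμ] at hfin

lemma SiteBound.mono {H : Op d} {P μ v v' : ℝ} (hP : 0 ≤ P) (hμ : 0 ≤ μ) (h : SiteBound G H P μ v)
    (hv : v ≤ v') : SiteBound G H P μ v' := by
  intro k Y hY A B hA hB t
  refine (h k Y hY A B hA hB t).trans ?_
  gcongr

/-- The trivial evolution. -/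
lemma siteBound_zero {μ v : ℝ} (hμ : 0 ≤ μ) (hv : 0 ≤ v) : SiteBound G (0 : Op d) 9 μ v := by
  intro k Y hY A B hA hB t
  have e : heis (0 : Op d) A t = A := by simp [heis]
  rw [e]
  by_cases hk : k ∈ Y
  · have h0 : setDist G {k} Y = 0 :=
      Nat.le_zero.1 ((setDist_le_dist (Finset.mem_singleton_self k) hk).trans (by simp))
    have h1 : 1 ≤ Real.exp (-(μ * setDist G {k} Y) + μ * v * |t|) := by
      rw [Real.one_le_exp_iff, h0]
      have : 0 ≤ μ * v * |t| := by positivity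
      simpa using this
    calc _ ≤ 2 * ‖A‖ * ‖B‖ := norm_lie_le A B
      _ = ‖A‖ * ‖B‖ * 2 := by ring
      _ ≤ _ := by gcongr; linarith
  · have hc : Commute A B := hA.commute hB (by simpa using hk)
    rw [Ring.lie_def, hc.eq, sub_self, norm_zero]
    positivity

lemma truncated_eq_zero (h : Finset V → Op d) {ℓ : ℝ} (hℓ : ℓ < 1) : truncated G h ℓ = 0 := by
  classical
  unfold truncated
  rw [Finset.filter_false_of_mem, Finset.sum_empty]
  intro Z _ hZ
  have h1 : 1 ≤ diam G Z := by unfold diam; omega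
  have h2 : (1 : ℝ) ≤ diam G Z := by exact_mod_cast h1
  linarith

lemma isSelfAdjoint_truncated {h : Finset V → Op d} (hh : IsInteraction h) (ℓ : ℝ) :
    IsSelfAdjoint (truncated G h ℓ) :=
  isSelfAdjoint_sum _ fun Z _ => (hh.isHermitian Z).isSelfAdjoint

open Classical in
lemma truncated_eq_add (h : Finset V → Op d) {ℓ ℓ' : ℝ} (hℓ : ℓ ≤ ℓ') :
    truncated G h ℓ' = truncated G h ℓ
      + ∑ Z ∈ Finset.univ.filter (fun Z : Finset V => ℓ < diam G Z ∧ (diam G Z : ℝ) ≤ ℓ'), h Z := by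
  unfold truncated
  rw [← Finset.sum_filter_add_sum_filter_not (Finset.univ.filter fun Z : Finset V =>
    (diam G Z : ℝ) ≤ ℓ') (fun Z => (diam G Z : ℝ) ≤ ℓ), Finset.filter_filter, Finset.filter_filter]
  congr 2
  · ext Z
    simp only [Finset.mem_filter, Finset.mem_univ, true_and]
    exact ⟨fun hZ => hZ.2, fun hZ => ⟨hZ.trans hℓ, hZ⟩⟩
  · ext Z
    simp only [Finset.mem_filter, Finset.mem_univ, true_and, not_le]
    exact and_comm

-- The decay assumption starts at `r = 1`, hence the use of `max 1 ℓ`; the resulting strength is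
-- valid for `ℓ < 1` too, since every diameter is at least 1.
open Classical in
lemma isPerturbation_shell {h : Finset V → Op d} (hh : IsInteraction h) {D : ℕ} {α g : ℝ}
    (hα : (D : ℝ) ≤ α) (hg : 0 < g) (hdec : PowerLawDecay G h D α g) {ℓ ℓ' : ℝ} (hℓ : 0 < ℓ) :
    IsPerturbation G h
      (Finset.univ.filter (fun Z : Finset V => ℓ < diam G Z ∧ (diam G Z : ℝ) ≤ ℓ')) ℓ'
      (g * ℓ ^ (-α + D)) where
  isSelfAdjoint Z _ := (hh.isHermitian Z).isSelfAdjoint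
  supportedOn Z _ := hh.supportedOn Z
  diam_le Z hZ := (Finset.mem_filter.1 hZ).2.2
  sum_le i := by
    refine le_trans ?_ ((hdec i (max 1 ℓ) (le_max_left _ _)).trans ?_)
    · refine Finset.sum_le_sum_of_subset_of_nonneg ?_ fun _ _ _ => norm_nonneg _
      intro Z hZ
      simp only [Finset.mem_filter, Finset.mem_univ, true_and] at hZ ⊢
      have h1 : 1 ≤ diam G Z := by unfold diam; omega
      have h2 : (1 : ℝ) ≤ diam G Z := by exact_mod_cast h1
      exact ⟨hZ.2, max_le h2 hZ.1.1.le⟩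
    · exact mul_le_mul_of_nonneg_left
        (Real.rpow_le_rpow_of_nonpos hℓ (le_max_right _ _) (by linarith)) hg.le

end Induction

-- The uniform velocity and the final bound.

universe u

/-- The velocity at range `ℓ` is taken as `v₀ (K - c ℓ ^ (-κ))`: with `c (1 - η ^ (-κ)) = η / 2` the
increments telescope, and `v₀ K` bounds all of them. There is no circularity in the constants: `K`
depends on `η` and `κ` only, it determines `C`, and `v₀` comes last, because `v / lam` involves only
the ratio `v / v₀ ≤ K`. -/
lemma exists_velocity (D : ℕ) (hD : 1 ≤ D) (α γ g : ℝ) (hα : 2 * (D : ℝ) + 1 < α)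
    (hγ : 1 ≤ γ) (hg : 0 < g) :
    ∃ vstar : ℝ, 0 < vstar ∧ ∀ (V : Type u) [Fintype V] [DecidableEq V] (G : SimpleGraph V),
      IsLattice G D γ → ∀ d : V → ℕ, (∀ i, 0 < d i) → ∀ h : Finset V → Op d, IsInteraction h →
        PowerLawDecay G h D α g → ∀ ℓ : ℝ, 0 < ℓ →
          SiteBound G (truncated G h ℓ) 9 (2 / ℓ) vstar := by
  obtain ⟨κ, hκ, hκ1, hκα⟩ := exists_exponent D hα
  obtain ⟨η, hη⟩ : ∃ η : ℝ, η = (8 * D + 4) / κ := ⟨_, rfl⟩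
  have hD0 : (1 : ℝ) ≤ D := by exact_mod_cast hD
  have hη12 : 12 ≤ η := by
    rw [hη, le_div_iff₀ hκ]; nlinarith
  have hη0 : 0 < η := by linarith
  have hηκ : η ^ (-κ) < 1 := Real.rpow_lt_one_of_one_lt_of_neg (by linarith) (by linarith)
  obtain ⟨c, hc⟩ : ∃ c : ℝ, c = η / 2 / (1 - η ^ (-κ)) := ⟨_, rfl⟩
  have hc0 : 0 < c := by
    have : 0 < 1 - η ^ (-κ) := by linarith
    rw [hc]; positivity
  obtain ⟨K, hK⟩ : ∃ K : ℝ, K = c * η ^ κ := ⟨_, rfl⟩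
  have hK0 : 0 < K := by rw [hK]; positivity
  obtain ⟨C, hC1, hC⟩ := exists_length_scale D (K := K) hκ (by linarith : 1 ≤ η)
  obtain ⟨v₀, hv₀⟩ : ∃ v₀ : ℝ, v₀ = 5184 * Real.exp 2 * γ ^ 4 * 8 ^ D * g * C ^ (D + 2 * κ) *
      (1 / η) ^ ((1 + κ) * (D + 1 + 2 * κ) - α + D) := ⟨_, rfl⟩
  have hv₀0 : 0 < v₀ := by rw [hv₀]; positivity
  refine ⟨v₀ * K, by positivity, fun V _ _ G hL d hd h hh hdec ℓ hℓ => ?_⟩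
  have hbase : ∀ ℓ : ℝ, 0 < ℓ → ℓ < 1 → ∀ v, 0 ≤ v →
      SiteBound G (truncated G h ℓ) 9 (2 / ℓ) v := by
    intro ℓ hℓ hℓ1 v hv
    rw [truncated_eq_zero h hℓ1]
    exact siteBound_zero (by positivity) hv
  have hvel : ∀ ℓ : ℝ, 1 / η ≤ ℓ → 0 ≤ v₀ * (K - c * ℓ ^ (-κ)) := by
    intro ℓ hℓ
    have h1 : ℓ ^ (-κ) ≤ (1 / η) ^ (-κ) :=
      Real.rpow_le_rpow_of_nonpos (by positivity) hℓ (by linarith)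
    rw [one_div, Real.inv_rpow hη0.le, Real.rpow_neg hη0.le, inv_inv] at h1
    refine mul_nonneg hv₀0.le (sub_nonneg.2 ?_)
    rw [hK]
    gcongr
  have hmain : ∀ n : ℕ, ∀ ℓ : ℝ, 1 / η ≤ ℓ → ℓ < η ^ n →
      SiteBound G (truncated G h ℓ) 9 (2 / ℓ) (v₀ * (K - c * ℓ ^ (-κ))) := by
    -- Below range 1 there are no terms and the evolution is trivial. The first nontrivial step
    -- starts from a range in `[1 / η, 1)`, where `K = c η ^ κ` keeps the velocity nonnegative.
    intro n
    induction n with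
    | zero =>
      intro ℓ hℓ hℓn
      exact hbase ℓ (lt_of_lt_of_le (by positivity) hℓ) (by simpa using hℓn) _ (hvel ℓ hℓ)
    | succ n ih =>
      intro ℓ' hℓ' hℓn
      have hℓ'0 : 0 < ℓ' := lt_of_lt_of_le (by positivity) hℓ'
      rcases lt_or_ge ℓ' 1 with h1 | h1
      · exact hbase ℓ' hℓ'0 h1 _ (hvel ℓ' hℓ')
      · obtain ⟨ℓ, rfl⟩ : ∃ ℓ, ℓ' = η * ℓ := ⟨ℓ' / η, by field_simp⟩
        have hℓ : 1 / η ≤ ℓ := by rwa [div_le_iff₀' hη0]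
        have hℓ0 : 0 < ℓ := lt_of_lt_of_le (by positivity) hℓ
        have hℓle : ℓ ≤ η * ℓ := by nlinarith
        have hn : ℓ < η ^ n := by
          rw [pow_succ'] at hℓn
          exact lt_of_mul_lt_mul_left hℓn hη0.le
        rw [truncated_eq_add h hℓle]
        refine (ih ℓ hℓ hn).scale_step hd hD hL hγ hg hκ hκ1 hκα hη hC1 hC hv₀ hℓ
          (isPerturbation_shell hh (by linarith) hg hdec hℓ0) (isSelfAdjoint_truncated hh ℓ)
          (hvel ℓ hℓ) ?_ ?_
        · gcongr
          have : 0 ≤ c * ℓ ^ (-κ) := by positivity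
          linarith
        · rw [Real.mul_rpow hη0.le hℓ0.le]
          have h2 : c * (1 - η ^ (-κ)) = η / 2 := by
            rw [hc]; field_simp [(by linarith : (1 - η ^ (-κ)) ≠ 0)]
          rw [← h2]
          exact le_of_eq (by ring)
  rcases lt_or_ge ℓ (1 / η) with h1 | h1
  · refine hbase ℓ hℓ (h1.trans ?_) _ (by positivity)
    rw [div_lt_one hη0]; linarith
  · obtain ⟨n, hn⟩ := pow_unbounded_of_one_lt ℓ (by linarith : 1 < η)
    refine (hmain n ℓ h1 hn).mono (by norm_num) (by positivity) ?_
    gcongr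
    have : 0 ≤ c * ℓ ^ (-κ) := by positivity
    linarith

/-- Passing from sites to sets doubles the prefactor 9. -/
lemma eighteen_le_C0 (D : ℕ) {γ : ℝ} (hγ : 1 ≤ γ) : 18 ≤ C0 D γ := by
  have h1 : (1 : ℝ) ≤ Real.exp (10 / 3) := Real.one_le_exp (by norm_num)
  have h2 : (1 : ℝ) ≤ 15 ^ D := one_le_pow₀ (by norm_num)
  have h3 : (1 : ℝ) ≤ (D ! : ℝ) := by exact_mod_cast Nat.factorial_pos D
  have h4 : (1 : ℝ) ≤ Real.exp 3 := Real.one_le_exp (by norm_num)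
  have h5 : (1 : ℝ) ≤ 45 ^ D := one_le_pow₀ (by norm_num)
  have h6 : (1 : ℝ) ≤ γ ^ 2 := one_le_pow₀ hγ
  have h7 : 16 ≤ zeta2 D γ := by
    unfold zeta2
    calc (16 : ℝ) = 16 * 1 * 1 * 1 := by norm_num
      _ ≤ _ := by gcongr
  unfold C0
  calc (18 : ℝ) ≤ 4 / 3 * 1 * 1 * 1 * 1 * 16 := by norm_num
    _ ≤ _ := by gcongr

end LongRange

end

theorem theorem2 (D : ℕ) (hD : 1 ≤ D) (α γ g : ℝ) (hα : 2 * (D : ℝ) + 1 < α)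
    (hγ : 1 ≤ γ) (hg : 0 < g) :
    ∃ vstar : ℝ, 0 < vstar ∧
      ∀ (V : Type*) [Fintype V] [DecidableEq V] (G : SimpleGraph V),
        LongRange.IsLattice G D γ →
        ∀ d : V → ℕ, (∀ i, 0 < d i) →
        ∀ h : Finset V → LongRange.Op d,
          LongRange.IsInteraction h →
          LongRange.PowerLawDecay G h D α g →
          ∀ ℓ : ℝ, 0 < ℓ →
            LongRange.LiebRobinsonBound G (LongRange.truncated G h ℓ)
              (fun x t X =>
                LongRange.C0 D γ * (X.card : ℝ) ^ 2 * (1 + x / ℓ) ^ (D - 1) *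
                  Real.exp (-2 * (x - vstar * |t|) / ℓ)) := by
  obtain ⟨vstar, hpos, hv⟩ := LongRange.exists_velocity D hD α γ g hα hγ hg
  refine ⟨vstar, hpos, fun V _ _ G hL d hd h hh hdec ℓ hℓ X Y hX hY A B hA hB t => ?_⟩
  have hH := LongRange.isSelfAdjoint_truncated (G := G) hh ℓ
  have h1 := (hv V G hL d hd h hh hdec ℓ hℓ).norm_lie_heis_le hd hH (by norm_num) (by positivity)
    hY hA hB t
  have h2 := LongRange.norm_lie_le (LongRange.heis (LongRange.truncated G h ℓ) A t) B
  rw [LongRange.norm_heis hH] at h2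
  rw [LongRange.evolve_eq_heis, ← Ring.lie_def]
  rcases min_choice (2 : ℝ) (LongRange.C0 D γ * (X.card : ℝ) ^ 2 *
    (1 + (LongRange.setDist G X Y : ℝ) / ℓ) ^ (D - 1) *
      Real.exp (-2 * ((LongRange.setDist G X Y : ℝ) - vstar * |t|) / ℓ)) with hm | hm
  · rw [hm]; linarith
  · rw [hm]
    refine h1.trans ?_
    -- The sum over sites gives `18 * X.card`; the claimed prefactor is larger, as the extra power
    -- of the cardinality and the polynomial in the distance are both at least 1.
    have hc : (1 : ℝ) ≤ X.card := by exact_mod_cast hX.card_pos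
    have h3 : (1 : ℝ) ≤ (1 + (LongRange.setDist G X Y : ℝ) / ℓ) ^ (D - 1) :=
      one_le_pow₀ (le_add_of_nonneg_right (by positivity))
    have h4 : (X.card : ℝ) ≤ (X.card : ℝ) ^ 2 := le_self_pow₀ hc (by norm_num)
    have e : -(2 / ℓ * (LongRange.setDist G X Y : ℝ)) + 2 / ℓ * vstar * |t|
        = -2 * ((LongRange.setDist G X Y : ℝ) - vstar * |t|) / ℓ := by ring
    rw [e]
    calc _ = ‖A‖ * ‖B‖ * (18 * X.card * 1 *
          Real.exp (-2 * ((LongRange.setDist G X Y : ℝ) - vstar * |t|) / ℓ)) := by ring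
      _ ≤ _ := by
          have h5 := LongRange.eighteen_le_C0 D hγ
          have h6 : 0 ≤ LongRange.C0 D γ := by linarith
          gcongr
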